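/- Let $M$ be a compact smooth manifold without boundary, of dimension $n$, and let $\mathcal{M}$ be the set of all smooth Riemannian metrics on $M$, an open cone in the Fréchet space $\Gamma(S^2T^*M)$ of smooth symmetric $(0,2)$-tensor fields with its $C^\infty$ topology. For $g\in\mathcal{M}$ let $dV_g$ be its Riemannian measure and $V_g=\int_M dV_g$ its total volume. The Ebin metric on $\mathcal{M}$ is $$ g_E(h,k)|_g=\int_M \operatorname{tr}(g^{-1}hg^{-1}k)\,dV_g,\qquad g\in\mathcal{M},\ h,k\in T_g\mathcal{M}=\Gamma(S^2T^*M), $$ and, for $p\in\mathbb{R}$, let $g_p|_g=V_g^{-p}\,g_E|_g$. Let $d_E(g,h)$ and $d_p(g,h)$ be the infimum of the lengths, with respect to $g_E$ and $g_p$ respectively, of the piecewise continuously differentiable curves in $\mathcal{M}$ from $g$ to $h$. For $0<v<v'<\infty$ put $\mathcal{M}_{v,v'}=\{g\in\mathcal{M} : v<V_g<v'\}$. If $p\neq 1$ and $0<v<v'<\infty$, then $d_p$ and $d_E$ (computed in $\mathcal{M}$) are finite and bi-Lipschitz equivalent on $\mathcal{M}_{v,v'}$: there is a constant $0\le C<\infty$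 such that for all $g,h\in\mathcal{M}_{v,v'}$ $$ d_p(g,h)\le C\,d_E(g,h)\quad\text{and}\quad d_E(g,h)\le C\,d_p(g,h). $$ -/

import Mathlib

open Set Filter Topology MeasureTheory Bundle
open scoped Manifold ContDiff ENNReal NNReal

noncomputable section

set_option synthInstance.maxHeartbeats 400000

namespace MetricSpaceOfMetrics

section Tensors

variable (n : ℕ) (M : Type*) [TopologicalSpace M]
  [ChartedSpace (EuclideanSpace ℝ (Fin n)) M] [IsManifold (𝓡 n) ∞ M]

/-- The space `Γ(T*M ⊗ T*M)` of smooth `(0,2)`-tensor fields on the `n`-manifold `M`: smooth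
sections of the bundle of bilinear forms on the tangent spaces. -/
abbrev TensorField02 : Type _ :=
  ContMDiffSection (𝓡 n)
    (EuclideanSpace ℝ (Fin n) →L[ℝ] EuclideanSpace ℝ (Fin n) →L[ℝ] ℝ) ∞
    (fun x : M => TangentSpace (𝓡 n) x →L[ℝ] TangentSpace (𝓡 n) x →L[ℝ] ℝ)

/-- The symmetric tensor fields, as a linear subspace of `Γ(T*M ⊗ T*M)`. -/
def symmetricTensors : Submodule ℝ (TensorField02 n M) where
  carrier := {s | ∀ (x : M) (u w : TangentSpace (𝓡 n) x), s x u w = s x w u}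
  add_mem' := by
    intro a b ha hb x u w
    simp [ha x u w, hb x u w]
  zero_mem' := by
    intro x u w
    simp
  smul_mem' := by
    intro c a ha x u w
    simp [ha x u w]

/-- The space `Γ(S²T*M)` of smooth symmetric `(0,2)`-tensor fields on `M`. -/
def SymTensorField : Type _ := symmetricTensors n M

instance : AddCommGroup (SymTensorField n M) :=
  inferInstanceAs (AddCommGroup (symmetricTensors n M))

instance : Module ℝ (SymTensorField n M) :=
  inferInstanceAs (Module ℝ (symmetricTensors n M))

variable {n M} in
/-- The value `s(x)(u, w)` of a tensor field. -/
def SymTensorField.val (s : SymTensorField n M) (x : M) (u w : TangentSpace (𝓡 n) x) : ℝ :=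
  (Subtype.val s : TensorField02 n M) x u w

/-- The set `𝓜` of all smooth Riemannian metrics on `M`, as a subset (an open convex cone) of
`Γ(S²T*M)`. -/
def Metrics : Set (SymTensorField n M) :=
  {g | ∀ (x : M) (u : TangentSpace (𝓡 n) x), u ≠ 0 → 0 < g.val x u u}

end Tensors

section Local

variable {n : ℕ} {M : Type*} [TopologicalSpace M]
  [ChartedSpace (EuclideanSpace ℝ (Fin n)) M] [IsManifold (𝓡 n) ∞ M]

/-- The coordinate vector field `∂ᵢ` of the chart `φ` of `M` around `x₀`, at the point `φ⁻¹(y)`: the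
image of the `i`-th standard basis vector under the differential of `φ⁻¹` at `y`. It is meaningful
on the (open) target of the chart only. -/
def coordVector (x₀ : M) (i : Fin n) (y : EuclideanSpace ℝ (Fin n)) :
    TangentSpace (𝓡 n) ((extChartAt (𝓡 n) x₀).symm y) :=
  mfderiv 𝓘(ℝ, EuclideanSpace ℝ (Fin n)) (𝓡 n) (extChartAt (𝓡 n) x₀).symm y
    (EuclideanSpace.single i (1 : ℝ))

/-- The components `sᵢⱼ = s(∂ᵢ, ∂ⱼ)` of a tensor field `s` in the chart of `M` around `x₀`, as
functions on the target of the chart. -/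
def components (x₀ : M) (s : SymTensorField n M) (y : EuclideanSpace ℝ (Fin n)) :
    Fin n → Fin n → ℝ :=
  fun i j => s.val ((extChartAt (𝓡 n) x₀).symm y) (coordVector x₀ i y) (coordVector x₀ j y)

/-- The matrix of `s(x)` in the standard basis of `T_xM`, which in Mathlib is a copy of `ℝⁿ`. -/
def matrixAt (s : SymTensorField n M) (x : M) : Matrix (Fin n) (Fin n) ℝ :=
  Matrix.of fun i j => s.val x
    (EuclideanSpace.single i (1 : ℝ) : EuclideanSpace ℝ (Fin n))
    (EuclideanSpace.single j (1 : ℝ) : EuclideanSpace ℝ (Fin n))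

/-- The Fréchet topology (the `C^∞` topology) of `Γ(S²T*M)`: the coarsest topology for which, in
every chart and for every order `k`, the `k`-th derivatives of the components converge uniformly on
the compact subsets of the target of the chart. -/
instance smoothTopology : TopologicalSpace (SymTensorField n M) :=
  ⨅ (x₀ : M) (k : ℕ), TopologicalSpace.induced
    (fun s : SymTensorField n M =>
      UniformOnFun.ofFun
        {K : Set (EuclideanSpace ℝ (Fin n)) | IsCompact K ∧ K ⊆ (extChartAt (𝓡 n) x₀).target}
        (iteratedFDeriv ℝ k (components x₀ s)))
    inferInstance

/-- The function `x ↦ tr (g⁻¹ h g⁻¹ k)` on `M`. The value of the trace does not depend on the basis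
of the tangent space in which the matrices are written. -/
def traceProduct (g h k : SymTensorField n M) (x : M) : ℝ :=
  ((matrixAt g x)⁻¹ * matrixAt h x * (matrixAt g x)⁻¹ * matrixAt k x).trace

end Local

section Volume

variable {n : ℕ} {M : Type*} [TopologicalSpace M] [T2Space M] [CompactSpace M]
  [ChartedSpace (EuclideanSpace ℝ (Fin n)) M] [IsManifold (𝓡 n) ∞ M]

variable (n M) in
/-- A smooth partition of unity on `M`, subordinate to the chart domains. -/
def chartPartition : SmoothPartitionOfUnity M (𝓡 n) M univ :=
  (SmoothPartitionOfUnity.exists_isSubordinate_chartAt_source (𝓡 n) M).choose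

variable (n M) in
theorem chartPartition_isSubordinate :
    (chartPartition n M).IsSubordinate
      (fun x => (chartAt (EuclideanSpace ℝ (Fin n)) x).source) :=
  (SmoothPartitionOfUnity.exists_isSubordinate_chartAt_source (𝓡 n) M).choose_spec

variable [MeasurableSpace M]

/-- The Riemannian measure of `g` on the domain of the chart around `x₀`: the measure
`√(det gᵢⱼ) dx¹ ⋯ dxⁿ` on the target of the chart, transported to `M`. -/
def chartVolume (g : SymTensorField n M) (x₀ : M) : Measure M :=
  (((volume : Measure (EuclideanSpace ℝ (Fin n))).restrict
      (extChartAt (𝓡 n) x₀).target).withDensity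
    (fun y => ENNReal.ofReal (Real.sqrt (Matrix.of (components x₀ g y)).det))).map
    (extChartAt (𝓡 n) x₀).symm

/-- The Riemannian measure `dV_g` on `M`, glued from its expressions `√(det gᵢⱼ) dx¹ ⋯ dxⁿ` in
charts by means of a partition of unity `(ρ_x)` subordinate to the chart domains:
`∫ f dV_g = ∑ₓ ∫ ρ_x f √(det gᵢⱼ) dx¹ ⋯ dxⁿ`. By the change of variables formula the result does
not depend on the partition of unity. No orientation is needed. -/
def volumeMeasure (g : SymTensorField n M) : Measure M :=
  Measure.sum fun x₀ : M =>
    (chartVolume g x₀).withDensity (fun x => ENNReal.ofReal (chartPartition n M x₀ x))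

/-- The total volume `V_g = ∫_M dV_g`. -/
def totalVolume (g : SymTensorField n M) : ℝ := (volumeMeasure g univ).toReal

/-- The Ebin metric `g_E(h, k)|_g = ∫_M tr (g⁻¹ h g⁻¹ k) dV_g`. -/
def ebinMetric (g h k : SymTensorField n M) : ℝ :=
  ∫ x, traceProduct g h k x ∂(volumeMeasure g)

/-- The conformally changed metric `g_p = V_g^(-p) g_E`. -/
def conformalEbinMetric (p : ℝ) (g h k : SymTensorField n M) : ℝ :=
  totalVolume g ^ (-p) * ebinMetric g h k

variable (n M) in
/-- The set `𝓜_{v,v'}` of the Riemannian metrics with `v < V_g < v'`. -/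
def metricsVolumeBetween (v v' : ℝ) : Set (SymTensorField n M) :=
  {g | g ∈ Metrics n M ∧ v < totalVolume g ∧ totalVolume g < v'}

end Volume

section Distance

variable {n : ℕ} {M : Type*} [TopologicalSpace M]
  [ChartedSpace (EuclideanSpace ℝ (Fin n)) M] [IsManifold (𝓡 n) ∞ M]

/-- `γ` is continuously differentiable on `[a, b]`, as a curve in the Fréchet space `Γ(S²T*M)`,
with derivative `γ'` (one-sided at the end points). -/
def IsC1CurveOn (γ γ' : ℝ → SymTensorField n M) (a b : ℝ) : Prop :=
  (∀ t ∈ Icc a b,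
    Tendsto (fun s : ℝ => (s - t)⁻¹ • (γ s - γ t)) (𝓝[Icc a b \ {t}] t) (𝓝 (γ' t))) ∧
  ContinuousOn γ' (Icc a b)

/-- A piecewise differentiable curve in `𝓜` from `g` to `h`, on the interval
`[node 0, node pieces]`: the curve is continuously differentiable on each of the intervals
`[node i, node (i + 1)]`, with derivative `velocity i`. -/
structure PiecewiseC1Path (g h : SymTensorField n M) where
  /-- the number of pieces -/
  pieces : ℕ
  /-- the subdivision of the parameter interval -/
  node : ℕ → ℝ
  /-- the curve -/
  curve : ℝ → SymTensorField n M
  /-- the derivatives of the pieces of the curve -/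
  velocity : ℕ → ℝ → SymTensorField n M
  node_lt : ∀ i < pieces, node i < node (i + 1)
  start_eq : curve (node 0) = g
  end_eq : curve (node pieces) = h
  mem_metrics : ∀ t ∈ Icc (node 0) (node pieces), curve t ∈ Metrics n M
  isC1 : ∀ i < pieces, IsC1CurveOn curve (velocity i) (node i) (node (i + 1))

/-- The length `∫ √(G(γ', γ')|_γ) dt` of a piecewise differentiable curve `γ` with respect to a
(weak) Riemannian metric `G` on `𝓜`; here `G g h k` is the inner product of the tangent vectors `h`
and `k` at `g`. -/
def PiecewiseC1Path.length {g h : SymTensorField n M} (γ : PiecewiseC1Path g h)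
    (G : SymTensorField n M → SymTensorField n M → SymTensorField n M → ℝ) : ℝ≥0∞ :=
  ∑ i ∈ Finset.range γ.pieces, ∫⁻ t in Icc (γ.node i) (γ.node (i + 1)),
    ENNReal.ofReal (Real.sqrt (G (γ.curve t) (γ.velocity i t) (γ.velocity i t)))

/-- The distance function on `𝓜` of a (weak) Riemannian metric `G` on `𝓜`: the infimum of the
lengths of the piecewise differentiable curves in `𝓜` between two points. -/
def riemannianDist (G : SymTensorField n M → SymTensorField n M → SymTensorField n M → ℝ)
    (g h : SymTensorField n M) : ℝ≥0∞ :=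
  ⨅ γ : PiecewiseC1Path g h, γ.length G

end Distance

section Distances

variable {n : ℕ} {M : Type*} [TopologicalSpace M] [T2Space M] [CompactSpace M]
  [ChartedSpace (EuclideanSpace ℝ (Fin n)) M] [IsManifold (𝓡 n) ∞ M] [MeasurableSpace M]

/-- The distance function `d_E` of the Ebin metric. -/
def ebinDist (g h : SymTensorField n M) : ℝ≥0∞ := riemannianDist ebinMetric g h

/-- The distance function `d_p` of the metric `g_p`. -/
def conformalEbinDist (p : ℝ) (g h : SymTensorField n M) : ℝ≥0∞ :=
  riemannianDist (conformalEbinMetric p) g h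

end Distances

end MetricSpaceOfMetrics

end

/-! Write `g_q = V^(-q) g_E` for any exponent `q ≠ 1`; the Ebin metric is `g_0`. It is enough to
bound `d_p` by a multiple of `d_q` on `𝓜_{v,v'}` for all `p, q ≠ 1`, since the pairs `(p, 0)` and
`(0, p)` then give both inequalities.

While the volume of a path stays in `[v/2, 2v']`, the factor `V^(q-p)` is bounded, so the
`g_p`-length is at most a constant times the `g_q`-length. Paths that leave this range are handled
by two facts.

Leaving is expensive. The first variation of volume is `dV(h) = ½ ∫ tr(g⁻¹h) dV_g`. The pointwise
inequality `tr(S)² ≤ n tr(S²)` and Cauchy–Schwarz give `|dV(h)| ≤ ½ √(n V g_E(h,h))`. Hence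
`V^((1-q)/2)` is Lipschitz for the `g_q`-length. As `q ≠ 1`, this power is strictly monotone in `V`,
so a path from `𝓜_{v,v'}` that leaves the range has `g_q`-length bounded below
(`PiecewiseC1Path.abs_rpow_totalVolume_sub_le`).

The diameter is bounded. The homothety by `c` multiplies `g_p`-lengths by `c^α`, where `α =
n(1-p)/4`. If `n ≠ 0` and `p ≠ 1`, choose `c` with `c^α` small: the segment from `c g` to `c h`
becomes short, while the rays from `g` to `c g` and from `h` to `c h` have length bounded in terms
of `v, v'` only. So `d_p ≤ D` on `𝓜_{v,v'}` (`exists_conformalEbinDist_le`). For a path that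
escapes, `d_p ≤ D` is then at most a constant times its `g_q`-length
(`exists_conformalEbinDist_le_mul`).

The analytic input is that all volumes and Ebin products are integrals against one fixed finite
measure `dV_g`, with integrands jointly continuous in time and point. -/

namespace MetricSpaceOfMetrics

/-! ### Tensor components and the coordinate frame in a chart -/

section Charts

variable {n : ℕ} {M : Type*} [TopologicalSpace M]
  [ChartedSpace (EuclideanSpace ℝ (Fin n)) M] [IsManifold (𝓡 n) ∞ M]

@[simp] theorem SymTensorField.val_add (s t : SymTensorField n M) (x : M)
    (u w : TangentSpace (𝓡 n) x) : (s + t).val x u w = s.val x u w + t.val x u w := rfl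

@[simp] theorem SymTensorField.val_sub (s t : SymTensorField n M) (x : M)
    (u w : TangentSpace (𝓡 n) x) : (s - t).val x u w = s.val x u w - t.val x u w := rfl

@[simp] theorem SymTensorField.val_smul (c : ℝ) (s : SymTensorField n M) (x : M)
    (u w : TangentSpace (𝓡 n) x) : (c • s).val x u w = c * s.val x u w := rfl

theorem SymTensorField.val_comm (s : SymTensorField n M) (x : M)
    (u w : TangentSpace (𝓡 n) x) : s.val x u w = s.val x w u := s.2 x u w

/-- The field is the tangent map of the inverse chart applied to a constant section of the tangent
bundle of `ℝⁿ`. -/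
theorem contMDiffOn_coordVector (x₀ : M) (i : Fin n) :
    ContMDiffOn 𝓘(ℝ, EuclideanSpace ℝ (Fin n)) ((𝓡 n).prod 𝓘(ℝ, EuclideanSpace ℝ (Fin n))) 0
      (fun y => TotalSpace.mk' (EuclideanSpace ℝ (Fin n)) ((extChartAt (𝓡 n) x₀).symm y)
        (coordVector x₀ i y)) (extChartAt (𝓡 n) x₀).target := by
  have ho := isOpen_extChartAt_target (I := 𝓡 n) x₀
  have h1 := (contMDiffOn_extChartAt_symm (I := 𝓡 n) (n := ∞) x₀).contMDiffOn_tangentMapWithin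
    (m := 0) (by simp) ho.uniqueMDiffOn
  have h2 : ContMDiff 𝓘(ℝ, EuclideanSpace ℝ (Fin n))
      (𝓘(ℝ, EuclideanSpace ℝ (Fin n)).prod 𝓘(ℝ, EuclideanSpace ℝ (Fin n))) 0
      (fun y : EuclideanSpace ℝ (Fin n) =>
        (⟨y, EuclideanSpace.single i (1 : ℝ)⟩ :
          TangentBundle 𝓘(ℝ, EuclideanSpace ℝ (Fin n)) (EuclideanSpace ℝ (Fin n)))) := by
    rw [contMDiff_zero_iff]
    rw [← (tangentBundleModelSpaceHomeomorph 𝓘(ℝ, EuclideanSpace ℝ (Fin n))).comp_continuous_iff]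
    exact continuous_id.prodMk continuous_const
  refine (h1.comp h2.contMDiffOn (fun y hy => hy)).congr fun y hy => ?_
  simp only [Function.comp, tangentMapWithin, mfderivWithin_of_isOpen ho hy]
  rfl

theorem continuousOn_components (x₀ : M) (s : SymTensorField n M) :
    ContinuousOn (components x₀ s) (extChartAt (𝓡 n) x₀).target := by
  refine continuousOn_pi.2 fun i => continuousOn_pi.2 fun j => ?_
  intro y hy
  have hs : ContMDiffWithinAt 𝓘(ℝ, EuclideanSpace ℝ (Fin n))
      ((𝓡 n).prod 𝓘(ℝ, EuclideanSpace ℝ (Fin n) →L[ℝ] EuclideanSpace ℝ (Fin n) →L[ℝ] ℝ)) 0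
      (fun y => TotalSpace.mk' (EuclideanSpace ℝ (Fin n) →L[ℝ] EuclideanSpace ℝ (Fin n) →L[ℝ] ℝ)
        (E := fun x : M => TangentSpace (𝓡 n) x →L[ℝ] TangentSpace (𝓡 n) x →L[ℝ]
          Bundle.Trivial M ℝ x)
        ((extChartAt (𝓡 n) x₀).symm y) ((Subtype.val s : TensorField02 n M) _))
      (extChartAt (𝓡 n) x₀).target y :=
    ((Subtype.val s : TensorField02 n M).contMDiff.of_le
      (by simp)).contMDiffAt.comp_contMDiffWithinAt y ((contMDiffOn_extChartAt_symm (I := 𝓡 n) (n := 0) x₀) y hy)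
  have h := ContMDiffWithinAt.clm_bundle_apply₂ (F₁ := EuclideanSpace ℝ (Fin n))
    (F₂ := EuclideanSpace ℝ (Fin n)) (F₃ := ℝ) (E₃ := Bundle.Trivial M ℝ) hs
    (contMDiffOn_coordVector x₀ i y hy) (contMDiffOn_coordVector x₀ j y hy)
  rw [contMDiffWithinAt_totalSpace] at h
  exact h.2.continuousWithinAt

theorem _root_.EuclideanSpace.eq_sum_smul_single (v : EuclideanSpace ℝ (Fin n)) :
    v = ∑ i, v i • EuclideanSpace.single i (1 : ℝ) := by
  ext k
  simp [Finset.sum_apply, Pi.single_apply]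

theorem _root_.EuclideanSpace.bilin_eq_sum
    (B : EuclideanSpace ℝ (Fin n) →L[ℝ] EuclideanSpace ℝ (Fin n) →L[ℝ] ℝ)
    (u w : EuclideanSpace ℝ (Fin n)) :
    B u w = ∑ i, ∑ j, u i *
      (B (EuclideanSpace.single i (1 : ℝ)) (EuclideanSpace.single j (1 : ℝ)) * w j) := by
  conv_lhs => rw [EuclideanSpace.eq_sum_smul_single u, EuclideanSpace.eq_sum_smul_single w]
  simp only [map_sum, map_smul, sum_apply, smul_apply, smul_eq_mul, Finset.mul_sum]
  rw [Finset.sum_comm]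
  exact Finset.sum_congr rfl fun i _ => Finset.sum_congr rfl fun j _ => by ring

theorem SymTensorField.val_eq_sum (s : SymTensorField n M) (x : M)
    (u w : EuclideanSpace ℝ (Fin n)) :
    s.val x u w = ∑ i, ∑ j, u i * (matrixAt s x i j * w j) :=
  EuclideanSpace.bilin_eq_sum ((Subtype.val s : TensorField02 n M) x) u w

/-- The matrix of the coordinate frame in the standard basis of the tangent space. -/
noncomputable def frameMatrix (x₀ : M) (y : EuclideanSpace ℝ (Fin n)) : Matrix (Fin n) (Fin n) ℝ :=
  Matrix.of fun i j => (show EuclideanSpace ℝ (Fin n) from coordVector x₀ j y) i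

/-- The standard basis of `T_xM` comes from the preferred chart at `x`, so `matrixAt s x` need not
be continuous in `x`; the chart components are. This congruence transfers continuity to the
invariant quantities: traces such as `tr(g⁻¹k)` and ratios of determinants. -/
theorem components_eq (x₀ : M) (s : SymTensorField n M) (y : EuclideanSpace ℝ (Fin n)) :
    Matrix.of (components x₀ s y) =
      (frameMatrix x₀ y).transpose * matrixAt s ((extChartAt (𝓡 n) x₀).symm y) *
        frameMatrix x₀ y := by
  refine Matrix.ext fun i j => ?_
  refine (SymTensorField.val_eq_sum s ((extChartAt (𝓡 n) x₀).symm y) (coordVector x₀ i y)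
    (coordVector x₀ j y)).trans ?_
  rw [Matrix.mul_assoc, Matrix.mul_apply]
  simp only [Matrix.mul_apply, Finset.mul_sum]
  rfl

theorem isUnit_frameMatrix (x₀ : M) {y : EuclideanSpace ℝ (Fin n)}
    (hy : y ∈ (extChartAt (𝓡 n) x₀).target) : IsUnit (frameMatrix x₀ y) := by
  have hinv : (mfderiv 𝓘(ℝ, EuclideanSpace ℝ (Fin n)) (𝓡 n)
      (extChartAt (𝓡 n) x₀).symm y).IsInvertible := by
    have h := isInvertible_mfderivWithin_extChartAt_symm (I := 𝓡 n) (x := x₀) hy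
    simpa using h
  let D : EuclideanSpace ℝ (Fin n) →L[ℝ] EuclideanSpace ℝ (Fin n) :=
    mfderiv 𝓘(ℝ, EuclideanSpace ℝ (Fin n)) (𝓡 n) (extChartAt (𝓡 n) x₀).symm y
  have hD : D.IsInvertible := hinv
  have hinj : Function.Injective D := hD.injective
  rw [← Matrix.mulVec_injective_iff_isUnit]
  intro a b hab
  have key (c : Fin n → ℝ) : (frameMatrix x₀ y).mulVec c = (D (WithLp.toLp 2 c)).ofLp := by
    ext i
    rw [EuclideanSpace.eq_sum_smul_single (WithLp.toLp 2 c)]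
    simp only [map_sum, map_smul, WithLp.ofLp_sum, Finset.sum_apply, Matrix.mulVec, dotProduct,
      WithLp.ofLp_smul, Pi.smul_apply, smul_eq_mul]
    refine Finset.sum_congr rfl fun j _ => ?_
    rw [mul_comm]
    rfl
  simp only [key] at hab
  have := hinj ((WithLp.ofLp_injective 2) hab)
  exact (WithLp.toLp_injective 2) this

end Charts

end MetricSpaceOfMetrics

namespace MetricSpaceOfMetrics

/-! ### Jacobi's formula and trace inequalities -/

section LinearAlgebra

variable {n : ℕ}

theorem hasDerivWithinAt_det {A : ℝ → Fin n → Fin n → ℝ} {A' : Fin n → Fin n → ℝ} {S : Set ℝ}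
    {t : ℝ} (hA : HasDerivWithinAt A A' S t) (hdet : (Matrix.of (A t)).det ≠ 0) :
    HasDerivWithinAt (fun s => (Matrix.of (A s)).det)
      ((Matrix.of (A t)).det * ((Matrix.of (A t))⁻¹ * Matrix.of A').trace) S t := by
  have hdiff : Differentiable ℝ fun B : Fin n → Fin n → ℝ => (Matrix.of B).det := by
    simp only [Matrix.det_apply, Matrix.of_apply]
    fun_prop
  have hf := (hdiff (A t)).hasFDerivAt
  have h1 := hf.comp_hasDerivWithinAt t hA
  have hline : HasDerivAt (fun r : ℝ => A t + r • A') A' 0 := by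
    simpa using ((hasDerivAt_id (0 : ℝ)).smul_const A').const_add (A t)
  have hf0 : HasFDerivAt (fun B : Fin n → Fin n → ℝ => (Matrix.of B).det)
      (fderiv ℝ (fun B : Fin n → Fin n → ℝ => (Matrix.of B).det) (A t))
      (A t + (0 : ℝ) • A') := by simpa using hf
  have h2 := hf0.comp_hasDerivAt (0 : ℝ) hline
  -- The determinant is polynomial, so only the value of its differential on `A'` is missing. It is
  -- read off along the line `A t + r A'`, from `det(1 + rX) = 1 + r tr X + O(r²)`, and identified
  -- by uniqueness of derivatives.
  have h3 : HasDerivAt (fun r : ℝ => (Matrix.of (A t + r • A')).det)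
      ((Matrix.of (A t)).det * ((Matrix.of (A t))⁻¹ * Matrix.of A').trace) 0 := by
    have hpoly (r : ℝ) : (Matrix.of (A t + r • A')).det = (Matrix.of (A t)).det *
        (1 + ((Matrix.of (A t))⁻¹ * Matrix.of A').trace * r +
          (Polynomial.eval r (Matrix.det (1 + (Polynomial.X : Polynomial ℝ) •
            ((Matrix.of (A t))⁻¹ * Matrix.of A').map Polynomial.C)).divX.divX) * r ^ 2) := by
      rw [← Matrix.det_one_add_smul, ← Matrix.det_mul, Matrix.mul_add, Matrix.mul_one,
        Matrix.mul_smul, ← Matrix.mul_assoc, Matrix.mul_nonsing_inv _ (isUnit_iff_ne_zero.2 hdet),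
        Matrix.one_mul]
      rfl
    simp only [hpoly]
    have hq := (Matrix.det (1 + (Polynomial.X : Polynomial ℝ) •
            ((Matrix.of (A t))⁻¹ * Matrix.of A').map Polynomial.C)).divX.divX.hasDerivAt (0 : ℝ)
    have := ((((hasDerivAt_id (0 : ℝ)).const_mul
      ((Matrix.of (A t))⁻¹ * Matrix.of A').trace).const_add 1).add
      (hq.mul ((hasDerivAt_id (0 : ℝ)).pow 2))).const_mul (Matrix.of (A t)).det
    simpa using this
  have h4 := h2.unique h3
  rw [← h4]
  exact h1

theorem trace_mul_self_eq_sum {S : Matrix (Fin n) (Fin n) ℝ} (hS : S.transpose = S) :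
    (S * S).trace = ∑ i, ∑ j, S i j ^ 2 := by
  simp only [Matrix.trace, Matrix.diag, Matrix.mul_apply]
  refine Finset.sum_congr rfl fun i _ => Finset.sum_congr rfl fun j _ => ?_
  have : S j i = S i j := congrFun (congrFun hS i) j
  rw [this, sq]

theorem trace_sq_le {S : Matrix (Fin n) (Fin n) ℝ} (hS : S.transpose = S) :
    S.trace ^ 2 ≤ n * (S * S).trace := by
  rw [trace_mul_self_eq_sum hS]
  have h1 : S.trace ^ 2 ≤ n * ∑ i, S i i ^ 2 := by
    have := sq_sum_le_card_mul_sum_sq (s := (Finset.univ : Finset (Fin n))) (f := fun i => S i i)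
    simpa [Matrix.trace] using this
  refine h1.trans (mul_le_mul_of_nonneg_left (Finset.sum_le_sum fun i _ => ?_) (by positivity))
  exact Finset.single_le_sum (f := fun j => S i j ^ 2) (fun j _ => sq_nonneg _) (Finset.mem_univ i)

/-- With `A = CᵀC`, the matrix `A⁻¹B` is conjugate by `C` to the symmetric matrix `S = C⁻ᵀBC⁻¹`.
This reduces inequalities between `tr(g⁻¹h)` and `tr(g⁻¹hg⁻¹h)` to symmetric matrices. -/
theorem exists_symm_of_posDef {A B : Matrix (Fin n) (Fin n) ℝ} (hA : A.PosDef)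
    (hB : B.transpose = B) : ∃ S : Matrix (Fin n) (Fin n) ℝ, S.transpose = S ∧
      (A⁻¹ * B).trace = S.trace ∧ (A⁻¹ * B * A⁻¹ * B).trace = (S * S).trace := by
  open scoped MatrixOrder Matrix.Norms.L2Operator in
  obtain ⟨C, hC⟩ := CStarAlgebra.nonneg_iff_eq_star_mul_self.mp hA.posSemidef.nonneg
  have hCA : A = C.transpose * C := by simpa [Matrix.star_eq_conjTranspose] using hC
  have hdC : IsUnit C.det := by
    have := hA.det_pos
    rw [hCA, Matrix.det_mul, Matrix.det_transpose] at this
    exact isUnit_iff_ne_zero.2 fun h => by simp [h] at this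
  have hinv : A⁻¹ = C⁻¹ * C⁻¹.transpose := by
    rw [hCA, Matrix.mul_inv_rev, Matrix.transpose_nonsing_inv]
  refine ⟨C⁻¹.transpose * B * C⁻¹, ?_, ?_, ?_⟩
  · simp only [Matrix.transpose_mul, Matrix.transpose_transpose, hB, Matrix.mul_assoc]
  · rw [hinv, Matrix.mul_assoc, Matrix.trace_mul_comm]
  · rw [hinv]
    have : C⁻¹ * C⁻¹.transpose * B * (C⁻¹ * C⁻¹.transpose) * B =
        C⁻¹ * (C⁻¹.transpose * B * C⁻¹ * C⁻¹.transpose * B) := by simp only [Matrix.mul_assoc]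
    rw [this, Matrix.trace_mul_comm]
    simp only [Matrix.mul_assoc]

theorem inv_transpose_mul_mul (P A : Matrix (Fin n) (Fin n) ℝ) :
    (P.transpose * A * P)⁻¹ = P⁻¹ * A⁻¹ * P⁻¹.transpose := by
  rw [Matrix.mul_inv_rev, Matrix.mul_inv_rev, Matrix.transpose_nonsing_inv, Matrix.mul_assoc]

theorem trace_inv_mul_congr {P : Matrix (Fin n) (Fin n) ℝ} (hP : IsUnit P)
    (A B : Matrix (Fin n) (Fin n) ℝ) :
    ((P.transpose * A * P)⁻¹ * (P.transpose * B * P)).trace = (A⁻¹ * B).trace := by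
  have hd := (Matrix.isUnit_iff_isUnit_det P).1 hP
  have h1 : P⁻¹.transpose * P.transpose = 1 := by
    rw [← Matrix.transpose_mul, Matrix.mul_nonsing_inv _ hd, Matrix.transpose_one]
  have : (P.transpose * A * P)⁻¹ * (P.transpose * B * P) = P⁻¹ * (A⁻¹ * B * P) := by
    rw [inv_transpose_mul_mul]
    calc _ = P⁻¹ * A⁻¹ * (P⁻¹.transpose * P.transpose) * B * P := by simp only [Matrix.mul_assoc]
      _ = _ := by rw [h1]; simp only [Matrix.mul_assoc, Matrix.one_mul]
  rw [this, Matrix.trace_mul_comm, Matrix.mul_assoc, Matrix.mul_nonsing_inv _ hd, Matrix.mul_one]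

theorem trace_inv_mul_inv_mul_congr {P : Matrix (Fin n) (Fin n) ℝ} (hP : IsUnit P)
    (A B C : Matrix (Fin n) (Fin n) ℝ) :
    ((P.transpose * A * P)⁻¹ * (P.transpose * B * P) *
      (P.transpose * A * P)⁻¹ * (P.transpose * C * P)).trace = (A⁻¹ * B * A⁻¹ * C).trace := by
  have hd := (Matrix.isUnit_iff_isUnit_det P).1 hP
  have h1 : P⁻¹.transpose * P.transpose = 1 := by
    rw [← Matrix.transpose_mul, Matrix.mul_nonsing_inv _ hd, Matrix.transpose_one]
  have h2 : P * P⁻¹ = 1 := Matrix.mul_nonsing_inv _ hd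
  have : (P.transpose * A * P)⁻¹ * (P.transpose * B * P) *
      (P.transpose * A * P)⁻¹ * (P.transpose * C * P) = P⁻¹ * (A⁻¹ * B * A⁻¹ * C * P) := by
    rw [inv_transpose_mul_mul]
    calc _ = P⁻¹ * A⁻¹ * (P⁻¹.transpose * P.transpose) * B * (P * P⁻¹) * A⁻¹ *
            (P⁻¹.transpose * P.transpose) * C * P := by simp only [Matrix.mul_assoc]
      _ = _ := by rw [h1, h2]; simp only [Matrix.mul_assoc, Matrix.one_mul]
  rw [this, Matrix.trace_mul_comm, Matrix.mul_assoc, h2, Matrix.mul_one]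

end LinearAlgebra

end MetricSpaceOfMetrics

namespace MetricSpaceOfMetrics

/-! ### Pointwise invariants of metrics and their chart expressions -/

section Pointwise

variable {n : ℕ} {M : Type*} [TopologicalSpace M]
  [ChartedSpace (EuclideanSpace ℝ (Fin n)) M] [IsManifold (𝓡 n) ∞ M]

theorem matrixAt_smul (c : ℝ) (s : SymTensorField n M) (x : M) :
    matrixAt (c • s) x = c • matrixAt s x := rfl

theorem transpose_matrixAt (s : SymTensorField n M) (x : M) :
    (matrixAt s x).transpose = matrixAt s x :=
  Matrix.ext fun _ _ => s.val_comm x _ _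

theorem posDef_matrixAt {g : SymTensorField n M} (hg : g ∈ Metrics n M) (x : M) :
    (matrixAt g x).PosDef := by
  refine Matrix.PosDef.of_dotProduct_mulVec_pos ?_ fun v hv => ?_
  · rw [Matrix.IsHermitian, Matrix.conjTranspose_eq_transpose_of_trivial, transpose_matrixAt]
  · have hne : (WithLp.toLp 2 v : EuclideanSpace ℝ (Fin n)) ≠ 0 := by
      simpa using hv
    have h := hg x (WithLp.toLp 2 v : EuclideanSpace ℝ (Fin n)) hne
    rw [SymTensorField.val_eq_sum g x (WithLp.toLp 2 v) (WithLp.toLp 2 v)] at h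
    simpa [dotProduct, Matrix.mulVec, Finset.mul_sum] using h

theorem det_matrixAt_pos {g : SymTensorField n M} (hg : g ∈ Metrics n M) (x : M) :
    0 < (matrixAt g x).det := (posDef_matrixAt hg x).det_pos

/-- The trace `tr (g⁻¹ k)`. -/
noncomputable def traceWith (g k : SymTensorField n M) (x : M) : ℝ := ((matrixAt g x)⁻¹ * matrixAt k x).trace

/-- The density `dV_k / dV_g = √(det k / det g)`. -/
noncomputable def volumeDensity (g k : SymTensorField n M) (x : M) : ℝ :=
  Real.sqrt ((matrixAt k x).det / (matrixAt g x).det)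

theorem volumeDensity_pos {g k : SymTensorField n M} (hg : g ∈ Metrics n M)
    (hk : k ∈ Metrics n M) (x : M) : 0 < volumeDensity g k x :=
  Real.sqrt_pos.2 (div_pos (det_matrixAt_pos hk x) (det_matrixAt_pos hg x))

theorem traceWith_sq_le {g : SymTensorField n M} (hg : g ∈ Metrics n M) (k : SymTensorField n M)
    (x : M) : traceWith g k x ^ 2 ≤ n * traceProduct g k k x := by
  obtain ⟨S, hS, h1, h2⟩ := exists_symm_of_posDef (posDef_matrixAt hg x) (transpose_matrixAt k x)
  rw [traceWith, traceProduct, h1, h2]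
  exact trace_sq_le hS

theorem traceProduct_nonneg {g : SymTensorField n M} (hg : g ∈ Metrics n M)
    (k : SymTensorField n M) (x : M) : 0 ≤ traceProduct g k k x := by
  obtain ⟨S, hS, -, h2⟩ := exists_symm_of_posDef (posDef_matrixAt hg x) (transpose_matrixAt k x)
  rw [traceProduct, h2, trace_mul_self_eq_sum hS]
  positivity

theorem det_components (x₀ : M) (s : SymTensorField n M) (y : EuclideanSpace ℝ (Fin n)) :
    (Matrix.of (components x₀ s y)).det = (frameMatrix x₀ y).det ^ 2 *
      (matrixAt s ((extChartAt (𝓡 n) x₀).symm y)).det := by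
  rw [components_eq, Matrix.det_mul, Matrix.det_mul, Matrix.det_transpose]
  ring

section InChart

variable (x₀ : M) {y : EuclideanSpace ℝ (Fin n)} (hy : y ∈ (extChartAt (𝓡 n) x₀).target)
include hy

theorem det_frameMatrix_ne_zero : (frameMatrix x₀ y).det ≠ 0 :=
  ((Matrix.isUnit_iff_isUnit_det _).1 (isUnit_frameMatrix x₀ hy)).ne_zero

theorem det_components_pos {g : SymTensorField n M} (hg : g ∈ Metrics n M) :
    0 < (Matrix.of (components x₀ g y)).det := by
  have := det_frameMatrix_ne_zero x₀ hy
  have := det_matrixAt_pos hg ((extChartAt (𝓡 n) x₀).symm y)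
  rw [det_components]
  positivity

theorem traceWith_chart (g k : SymTensorField n M) :
    traceWith g k ((extChartAt (𝓡 n) x₀).symm y) =
      ((Matrix.of (components x₀ g y))⁻¹ * Matrix.of (components x₀ k y)).trace := by
  rw [components_eq, components_eq, trace_inv_mul_congr (isUnit_frameMatrix x₀ hy)]
  rfl

theorem traceProduct_chart (g h k : SymTensorField n M) :
    traceProduct g h k ((extChartAt (𝓡 n) x₀).symm y) =
      ((Matrix.of (components x₀ g y))⁻¹ * Matrix.of (components x₀ h y) *
        (Matrix.of (components x₀ g y))⁻¹ * Matrix.of (components x₀ k y)).trace := by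
  rw [components_eq, components_eq, components_eq,
    trace_inv_mul_inv_mul_congr (isUnit_frameMatrix x₀ hy)]
  rfl

theorem volumeDensity_chart (g k : SymTensorField n M) :
    volumeDensity g k ((extChartAt (𝓡 n) x₀).symm y) =
      Real.sqrt ((Matrix.of (components x₀ k y)).det / (Matrix.of (components x₀ g y)).det) := by
  have := det_frameMatrix_ne_zero x₀ hy
  rw [det_components, det_components, mul_div_mul_left _ _ (pow_ne_zero 2 this)]
  rfl

end InChart

end Pointwise

/-! ### Joint continuity in time and point along curves of metrics -/

section ChartwiseContinuity

variable {n : ℕ} {M : Type*} [TopologicalSpace M] [ChartedSpace (EuclideanSpace ℝ (Fin n)) M]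

theorem continuousOn_prod_univ_of_charts {S : Set ℝ} {f : ℝ × M → ℝ}
    (h : ∀ x₀ : M, ContinuousOn
      (fun q : ℝ × EuclideanSpace ℝ (Fin n) => f (q.1, (extChartAt (𝓡 n) x₀).symm q.2))
      (S ×ˢ (extChartAt (𝓡 n) x₀).target)) : ContinuousOn f (S ×ˢ univ) := by
  rintro ⟨t, x⟩ ⟨ht, -⟩
  have hsrc : (extChartAt (𝓡 n) x).source ∈ 𝓝 x := extChartAt_source_mem_nhds x
  have hmaps : ContinuousWithinAt (fun q : ℝ × M => (q.1, extChartAt (𝓡 n) x q.2))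
      (S ×ˢ (extChartAt (𝓡 n) x).source) (t, x) :=
    (continuousOn_fst.prodMk ((continuousOn_extChartAt x).comp continuousOn_snd
      fun _ hq => hq.2)) _ ⟨ht, mem_extChartAt_source x⟩
  have h1 := (h x _ ⟨ht, mem_extChartAt_target x⟩).comp (x := (t, x)) hmaps
    (fun q hq => ⟨hq.1, (extChartAt (𝓡 n) x).map_source hq.2⟩)
  have h2 : ContinuousWithinAt f (S ×ˢ (extChartAt (𝓡 n) x).source) (t, x) :=
    h1.congr (fun q hq => by
      simp only [Function.comp, (extChartAt (𝓡 n) x).left_inv hq.2, Prod.mk.eta])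
      (by simp only [Function.comp, extChartAt_to_inv])
  refine h2.mono_of_mem_nhdsWithin ?_
  rw [nhdsWithin_prod_eq, nhdsWithin_univ]
  exact prod_mem_prod self_mem_nhdsWithin hsrc

end ChartwiseContinuity

theorem continuous_of_continuousOn_prod_univ {M : Type*} [TopologicalSpace M] {S : Set ℝ}
    {f : ℝ × M → ℝ} (h : ContinuousOn f (S ×ˢ univ)) {t : ℝ} (ht : t ∈ S) :
    Continuous fun x => f (t, x) :=
  h.comp_continuous (by fun_prop) fun _ => ⟨ht, mem_univ _⟩

section JointContinuity

variable {n : ℕ} {M : Type*} [TopologicalSpace M]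
  [ChartedSpace (EuclideanSpace ℝ (Fin n)) M] [IsManifold (𝓡 n) ∞ M]

/-- The components of `γ t` in every chart depend continuously on `t` and on the point jointly. -/
def JointlyContinuousOn (γ : ℝ → SymTensorField n M) (S : Set ℝ) : Prop :=
  ∀ x₀ : M, ContinuousOn (fun q : ℝ × EuclideanSpace ℝ (Fin n) => components x₀ (γ q.1) q.2)
    (S ×ˢ (extChartAt (𝓡 n) x₀).target)

theorem JointlyContinuousOn.const (s : SymTensorField n M) (S : Set ℝ) :
    JointlyContinuousOn (fun _ => s) S := fun x₀ =>
  (continuousOn_components x₀ s).comp continuousOn_snd fun _ hq => hq.2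

/-- Only the order-zero part of the `C^∞` topology enters the proof, and it does so here. -/
theorem tendstoUniformlyOn_components {ι : Type*} {l : Filter ι} {F : ι → SymTensorField n M}
    {s : SymTensorField n M} (h : Tendsto F l (𝓝 s)) (x₀ : M)
    {K : Set (EuclideanSpace ℝ (Fin n))} (hK : IsCompact K)
    (hKt : K ⊆ (extChartAt (𝓡 n) x₀).target) :
    TendstoUniformlyOn (fun i => components x₀ (F i)) (components x₀ s) l K := by
  have hle : smoothTopology (n := n) (M := M) ≤ _ := iInf₂_le x₀ 0
  have hc := continuous_iff_le_induced.2 hle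
  have h1 := (hc.tendsto s).comp h
  have h2 := UniformOnFun.tendsto_iff_tendstoUniformlyOn.1 h1 K ⟨hK, hKt⟩
  rw [Metric.tendstoUniformlyOn_iff] at h2 ⊢
  intro ε hε
  filter_upwards [h2 ε hε] with i hi y hy
  have := hi y hy
  refine lt_of_eq_of_lt ?_ this
  exact ((continuousMultilinearCurryFin0 ℝ (EuclideanSpace ℝ (Fin n))
    (Fin n → Fin n → ℝ)).symm.dist_map _ _).symm

theorem jointlyContinuousOn_of_tendstoUniformlyOn {γ : ℝ → SymTensorField n M} {S : Set ℝ}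
    (h : ∀ t ∈ S, ∀ (x₀ : M) (K : Set (EuclideanSpace ℝ (Fin n))), IsCompact K →
      K ⊆ (extChartAt (𝓡 n) x₀).target →
      TendstoUniformlyOn (fun r => components x₀ (γ r)) (components x₀ (γ t)) (𝓝[S] t) K) :
    JointlyContinuousOn γ S := by
  rintro x₀ ⟨t, y⟩ ⟨ht, hy⟩
  obtain ⟨K, hKy, hKt, hK⟩ := local_compact_nhds
    ((isOpen_extChartAt_target (I := 𝓡 n) x₀).mem_nhds hy)
  have hu := h t ht x₀ K hK hKt
  have hcont := continuousOn_components x₀ (γ t) y hy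
  rw [ContinuousWithinAt, Metric.tendsto_nhds]
  intro ε hε
  rw [Metric.tendstoUniformlyOn_iff] at hu
  rw [ContinuousWithinAt, Metric.tendsto_nhds] at hcont
  have e1 := hu (ε / 2) (half_pos hε)
  have e2 := hcont (ε / 2) (half_pos hε)
  rw [nhdsWithin_prod_eq]
  filter_upwards [e1.prod_mk (e2.and (mem_nhdsWithin_of_mem_nhds hKy))] with q hq
  have a1 := hq.1 q.2 hq.2.2
  have a2 := hq.2.1
  calc dist (components x₀ (γ q.1) q.2) (components x₀ (γ t) y)
      ≤ dist (components x₀ (γ q.1) q.2) (components x₀ (γ t) q.2) +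
        dist (components x₀ (γ t) q.2) (components x₀ (γ t) y) := dist_triangle _ _ _
    _ < ε / 2 + ε / 2 := add_lt_add (by rwa [dist_comm]) a2
    _ = ε := add_halves ε

theorem JointlyContinuousOn.of_continuousOn {γ : ℝ → SymTensorField n M} {S : Set ℝ}
    (h : ContinuousOn γ S) : JointlyContinuousOn γ S :=
  jointlyContinuousOn_of_tendstoUniformlyOn fun t ht x₀ _ hK hKt =>
    tendstoUniformlyOn_components (h t ht) x₀ hK hKt

theorem components_sub (x₀ : M) (s t : SymTensorField n M) (y : EuclideanSpace ℝ (Fin n)) :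
    components x₀ (s - t) y = components x₀ s y - components x₀ t y := rfl

theorem components_smul (x₀ : M) (c : ℝ) (s : SymTensorField n M)
    (y : EuclideanSpace ℝ (Fin n)) : components x₀ (c • s) y = c • components x₀ s y := rfl

/-- Uniform convergence of the difference quotients on a compact `K` bounds them near `t`, so the
components satisfy a Lipschitz estimate at `t`, uniformly over `K`. -/
theorem IsC1CurveOn.jointlyContinuousOn {γ γ' : ℝ → SymTensorField n M} {a b : ℝ}
    (h : IsC1CurveOn γ γ' a b) : JointlyContinuousOn γ (Icc a b) := by
  refine jointlyContinuousOn_of_tendstoUniformlyOn fun t ht x₀ K hK hKt => ?_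
  have hu := tendstoUniformlyOn_components (h.1 t ht) x₀ hK hKt
  obtain ⟨B, hB⟩ := hK.exists_bound_of_continuousOn ((continuousOn_components x₀ (γ' t)).mono hKt)
  have hB0 : 0 < |B| + 1 := by positivity
  rw [Metric.tendstoUniformlyOn_iff] at hu ⊢
  intro ε hε
  -- Difference quotients are controlled only off `t`; the point `t` itself is trivial and is split
  -- off.
  rw [← insert_sdiff_self_of_mem ht, nhdsWithin_insert, eventually_sup]
  refine ⟨by simpa using fun _ _ => hε, ?_⟩
  have hball : ∀ᶠ s in 𝓝[Icc a b \ {t}] t, dist s t < ε / (|B| + 1) :=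
    mem_nhdsWithin_of_mem_nhds (Metric.ball_mem_nhds t (by positivity))
  filter_upwards [hu 1 one_pos, hball, self_mem_nhdsWithin] with s hs hst hsm y hy
  have hne : s - t ≠ 0 := sub_ne_zero.2 hsm.2
  have h1 := hs y hy
  rw [components_smul, components_sub] at h1
  rw [dist_comm, dist_eq_norm]
  set D := components x₀ (γ s) y - components x₀ (γ t) y
  have h2 : ‖(s - t)⁻¹ • D‖ < |B| + 1 := by
    have := norm_sub_norm_le ((s - t)⁻¹ • D) (components x₀ (γ' t) y)
    rw [← dist_eq_norm, dist_comm] at this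
    have := hB y hy
    have := le_abs_self B
    linarith
  have h3 : D = (s - t) • ((s - t)⁻¹ • D) := by rw [smul_smul, mul_inv_cancel₀ hne, one_smul]
  rw [h3, norm_smul]
  rw [dist_eq_norm, lt_div_iff₀ hB0] at hst
  exact (mul_le_mul_of_nonneg_left h2.le (norm_nonneg _)).trans_lt hst

theorem IsC1CurveOn.hasDerivWithinAt_components {γ γ' : ℝ → SymTensorField n M} {a b t : ℝ}
    (h : IsC1CurveOn γ γ' a b) (ht : t ∈ Icc a b) (x₀ : M) {y : EuclideanSpace ℝ (Fin n)}
    (hy : y ∈ (extChartAt (𝓡 n) x₀).target) :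
    HasDerivWithinAt (fun s => components x₀ (γ s) y) (components x₀ (γ' t) y) (Icc a b) t := by
  rw [hasDerivWithinAt_iff_tendsto_slope]
  exact (tendstoUniformlyOn_components (h.1 t ht) x₀ isCompact_singleton
    (singleton_subset_iff.2 hy)).tendsto_at (mem_singleton y)

theorem _root_.ContinuousOn.matrix_inv_of_det_ne_zero {X : Type*} [TopologicalSpace X] {S : Set X}
    {A : X → Matrix (Fin n) (Fin n) ℝ} (hA : ContinuousOn A S) (h : ∀ x ∈ S, (A x).det ≠ 0) :
    ContinuousOn (fun x => (A x)⁻¹) S := by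
  rw [continuousOn_iff_continuous_domRestrict] at hA ⊢
  have hd : Continuous fun x : S => ((A x).det)⁻¹ :=
    hA.matrix_det.inv₀ fun x => h x x.2
  have : S.domRestrict (fun x => (A x)⁻¹) = fun x : S => ((A x).det)⁻¹ • (A x).adjugate := by
    ext1 x
    simp [Matrix.inv_def, Set.domRestrict]
  rw [this]
  exact hd.smul hA.matrix_adjugate

variable {γ η ζ : ℝ → SymTensorField n M} {S : Set ℝ}

theorem JointlyContinuousOn.matrix (hγ : JointlyContinuousOn γ S) (x₀ : M) :
    ContinuousOn (fun q : ℝ × EuclideanSpace ℝ (Fin n) => Matrix.of (components x₀ (γ q.1) q.2))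
      (S ×ˢ (extChartAt (𝓡 n) x₀).target) := hγ x₀

theorem JointlyContinuousOn.matrix_inv (hγ : JointlyContinuousOn γ S)
    (hm : ∀ t ∈ S, γ t ∈ Metrics n M) (x₀ : M) :
    ContinuousOn
      (fun q : ℝ × EuclideanSpace ℝ (Fin n) => (Matrix.of (components x₀ (γ q.1) q.2))⁻¹)
      (S ×ˢ (extChartAt (𝓡 n) x₀).target) :=
  ContinuousOn.matrix_inv_of_det_ne_zero (hγ.matrix x₀)
    fun _ hq => (det_components_pos x₀ hq.2 (hm _ hq.1)).ne'

theorem JointlyContinuousOn.continuousOn_traceProduct (hγ : JointlyContinuousOn γ S)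
    (hη : JointlyContinuousOn η S) (hζ : JointlyContinuousOn ζ S)
    (hm : ∀ t ∈ S, γ t ∈ Metrics n M) :
    ContinuousOn (fun q : ℝ × M => traceProduct (γ q.1) (η q.1) (ζ q.1) q.2) (S ×ˢ univ) := by
  apply continuousOn_prod_univ_of_charts (n := n)
  intro x₀
  have hinv := hγ.matrix_inv hm x₀
  have key := continuous_id.matrix_trace.comp_continuousOn
    (((hinv.mul (hη.matrix x₀)).mul hinv).mul (hζ.matrix x₀))
  refine key.congr ?_
  intro q hq
  dsimp only
  rw [traceProduct_chart x₀ hq.2]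
  rfl

theorem JointlyContinuousOn.continuousOn_traceWith (hγ : JointlyContinuousOn γ S)
    (hη : JointlyContinuousOn η S) (hm : ∀ t ∈ S, γ t ∈ Metrics n M) :
    ContinuousOn (fun q : ℝ × M => traceWith (γ q.1) (η q.1) q.2) (S ×ˢ univ) := by
  apply continuousOn_prod_univ_of_charts (n := n)
  intro x₀
  have key := continuous_id.matrix_trace.comp_continuousOn
    ((hγ.matrix_inv hm x₀).mul (hη.matrix x₀))
  refine key.congr ?_
  intro q hq
  dsimp only
  rw [traceWith_chart x₀ hq.2]
  rfl

theorem JointlyContinuousOn.continuousOn_volumeDensity (hγ : JointlyContinuousOn γ S)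
    {g : SymTensorField n M} (hg : g ∈ Metrics n M) :
    ContinuousOn (fun q : ℝ × M => volumeDensity g (γ q.1) q.2) (S ×ˢ univ) := by
  apply continuousOn_prod_univ_of_charts (n := n)
  intro x₀
  have hdet : Continuous fun A : Matrix (Fin n) (Fin n) ℝ => A.det := continuous_id.matrix_det
  have key := ((hdet.comp_continuousOn (hγ.matrix x₀)).div
    (hdet.comp_continuousOn ((JointlyContinuousOn.const g S).matrix x₀))
    fun _ hq => (det_components_pos x₀ hq.2 hg).ne').sqrt
  refine key.congr ?_
  intro q hq
  dsimp only
  rw [volumeDensity_chart x₀ hq.2]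
  rfl

theorem continuous_volumeDensity {g : SymTensorField n M} (hg : g ∈ Metrics n M)
    (k : SymTensorField n M) : Continuous (volumeDensity g k) :=
  continuous_of_continuousOn_prod_univ
    ((JointlyContinuousOn.const k univ).continuousOn_volumeDensity hg) (mem_univ 0)

/-- The first variation of the volume density. -/
theorem IsC1CurveOn.hasDerivWithinAt_volumeDensity {γ γ' : ℝ → SymTensorField n M} {a b t : ℝ}
    (h : IsC1CurveOn γ γ' a b) (hm : ∀ s ∈ Icc a b, γ s ∈ Metrics n M) (ht : t ∈ Icc a b)
    {g : SymTensorField n M} (hg : g ∈ Metrics n M) (x : M) :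
    HasDerivWithinAt (fun s => volumeDensity g (γ s) x)
      (traceWith (γ t) (γ' t) x * volumeDensity g (γ t) x / 2) (Icc a b) t := by
  have hy := mem_extChartAt_target (I := 𝓡 n) x
  set y := extChartAt (𝓡 n) x x
  have hx : (extChartAt (𝓡 n) x).symm y = x := extChartAt_to_inv x
  have hdens (k : SymTensorField n M) : volumeDensity g k x =
      Real.sqrt ((Matrix.of (components x k y)).det / (Matrix.of (components x g y)).det) := by
    rw [← volumeDensity_chart x hy, hx]
  have htr : traceWith (γ t) (γ' t) x =
      ((Matrix.of (components x (γ t) y))⁻¹ * Matrix.of (components x (γ' t) y)).trace := by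
    rw [← traceWith_chart x hy, hx]
  have hpos := det_components_pos x hy (hm t ht)
  have hgpos := det_components_pos x hy hg
  simp only [hdens, htr]
  have hd := ((hasDerivWithinAt_det (h.hasDerivWithinAt_components ht x hy) hpos.ne').div_const
    (Matrix.of (components x g y)).det).sqrt (div_pos hpos hgpos).ne'
  refine hd.congr_deriv ?_
  set D := (Matrix.of (components x (γ t) y)).det
  set G := (Matrix.of (components x g y)).det
  have hs : 0 < Real.sqrt (D / G) := Real.sqrt_pos.2 (div_pos hpos hgpos)
  have hsq : D / G = Real.sqrt (D / G) * Real.sqrt (D / G) :=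
    (Real.mul_self_sqrt (div_pos hpos hgpos).le).symm
  rw [mul_div_right_comm D, hsq]
  generalize Real.sqrt (D / G) = r at hs hsq ⊢
  have hr : Real.sqrt (r * r) = r := Real.sqrt_mul_self hs.le
  rw [hr]
  field_simp

end JointContinuity

end MetricSpaceOfMetrics

/-- Almost everywhere measurability of `f` is the right generality: the inverse chart is controlled
only on the chart target. -/
theorem MeasureTheory.Measure.map_withDensity_comp {X Y : Type*} [MeasurableSpace X]
    [MeasurableSpace Y] {μ : Measure X} {f : X → Y} (hf : AEMeasurable f μ) {d : Y → ℝ≥0∞}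
    (hd : Measurable d) :
    (μ.withDensity (d ∘ f)).map f = (μ.map f).withDensity d := by
  have hf' : AEMeasurable f (μ.withDensity (d ∘ f)) :=
    hf.mono_ac (withDensity_absolutelyContinuous _ _)
  ext s hs
  rw [Measure.map_apply_of_aemeasurable hf' hs, withDensity_apply _ hs,
    ← lintegral_indicator hs, lintegral_map' (hd.indicator hs).aemeasurable hf,
    withDensity_apply₀ _ (hf.nullMeasurableSet_preimage hs),
    ← lintegral_indicator₀ (hf.nullMeasurableSet_preimage hs)]
  rfl

namespace MetricSpaceOfMetrics

/-! ### Integrals over a compact space and change of density -/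

section CompactIntegrals

variable {M : Type*} [TopologicalSpace M] [CompactSpace M] [MeasurableSpace M] [BorelSpace M]

theorem integrable_of_continuous {μ : Measure M} [IsFiniteMeasure μ] {f : M → ℝ}
    (hf : Continuous f) : Integrable f μ := by
  obtain ⟨C, hC⟩ := isCompact_univ.exists_bound_of_continuousOn hf.continuousOn
  exact Integrable.of_bound hf.measurable.aestronglyMeasurable C
    (ae_of_all _ fun x => hC x (mem_univ x))

theorem continuousOn_integral_of_continuousOn_prod {μ : Measure M} [IsFiniteMeasure μ] {a b : ℝ}
    {f : ℝ × M → ℝ} (hf : ContinuousOn f (Icc a b ×ˢ univ)) :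
    ContinuousOn (fun t => ∫ x, f (t, x) ∂μ) (Icc a b) := by
  obtain ⟨C, hC⟩ := (isCompact_Icc.prod isCompact_univ).exists_bound_of_continuousOn hf
  refine continuousOn_of_dominated (bound := fun _ => C) ?_ ?_ (integrable_const C) ?_
  · exact fun t ht =>
      (continuous_of_continuousOn_prod_univ hf ht).measurable.aestronglyMeasurable
  · exact fun t ht => ae_of_all _ fun x => hC (t, x) ⟨ht, mem_univ x⟩
  · exact ae_of_all _ fun x => hf.comp (by fun_prop) fun t ht => ⟨ht, mem_univ x⟩

end CompactIntegrals

section VolumeFacts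

variable {n : ℕ} {M : Type*} [TopologicalSpace M]
  [ChartedSpace (EuclideanSpace ℝ (Fin n)) M] [IsManifold (𝓡 n) ∞ M]

theorem volumeDensity_nonneg (g k : SymTensorField n M) (x : M) : 0 ≤ volumeDensity g k x :=
  Real.sqrt_nonneg _

theorem measurable_ofReal_volumeDensity [MeasurableSpace M] [BorelSpace M]
    {g : SymTensorField n M} (hg : g ∈ Metrics n M)
    (k : SymTensorField n M) : Measurable fun x => ENNReal.ofReal (volumeDensity g k x) :=
  (continuous_volumeDensity hg k).measurable.ennreal_ofReal

/-- On the chart target `√det k = √det g · √(det k / det g)`, and the last factor is a function on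
`M` independent of the chart. It therefore survives the gluing by the partition of unity. -/
theorem chartVolume_eq_withDensity [MeasurableSpace M] [BorelSpace M]
    {g : SymTensorField n M} (hg : g ∈ Metrics n M)
    (k : SymTensorField n M) (x₀ : M) :
    chartVolume k x₀ =
      (chartVolume g x₀).withDensity fun x => ENNReal.ofReal (volumeDensity g k x) := by
  have hT : MeasurableSet (extChartAt (𝓡 n) x₀).target :=
    (isOpen_extChartAt_target (I := 𝓡 n) x₀).measurableSet
  set ν := (volume : Measure (EuclideanSpace ℝ (Fin n))).restrict (extChartAt (𝓡 n) x₀).target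
  have hψ : AEMeasurable (extChartAt (𝓡 n) x₀).symm ν :=
    (continuousOn_extChartAt_symm x₀).aemeasurable hT
  have hdet : Continuous fun A : Fin n → Fin n → ℝ => (Matrix.of A).det :=
    Continuous.matrix_det continuous_id
  have hfg : AEMeasurable
      (fun y => ENNReal.ofReal (Real.sqrt (Matrix.of (components x₀ g y)).det)) ν :=
    ((hdet.comp_continuousOn (continuousOn_components x₀ g)).sqrt.aemeasurable hT).ennreal_ofReal
  have hd := measurable_ofReal_volumeDensity hg k
  have hdψ := hd.comp_aemeasurable hψ
  rw [chartVolume, chartVolume, ← Measure.map_withDensity_comp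
    (hψ.mono_ac (withDensity_absolutelyContinuous _ _)) hd]
  rw [← withDensity_mul₀ hfg hdψ]
  congr 1
  refine withDensity_congr_ae ?_
  filter_upwards [ae_restrict_mem hT] with y hy
  simp only [Pi.mul_apply, Function.comp, volumeDensity_chart x₀ hy]
  have h1 := det_components_pos x₀ hy hg
  rw [← ENNReal.ofReal_mul (Real.sqrt_nonneg _), ← Real.sqrt_mul h1.le, mul_div_cancel₀ _ h1.ne']

variable [T2Space M] [CompactSpace M] [MeasurableSpace M]

/-- The convention `⊤.toReal = 0` makes positive volume imply finite volume, so no estimate on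
charts is needed. -/
theorem isFiniteMeasure_volumeMeasure {g : SymTensorField n M} (h : 0 < totalVolume g) :
    IsFiniteMeasure (volumeMeasure g) :=
  ⟨lt_top_iff_ne_top.2 fun htop => by simp [totalVolume, htop] at h⟩

theorem ebinMetric_nonneg {k : SymTensorField n M} (hk : k ∈ Metrics n M)
    (s : SymTensorField n M) : 0 ≤ ebinMetric k s s :=
  integral_nonneg fun x => traceProduct_nonneg hk s x

end VolumeFacts

/-! ### Volume and Ebin metric as integrals against a fixed measure; first variation of volume -/

section Volume

variable {n : ℕ} {M : Type*} [TopologicalSpace M] [T2Space M] [CompactSpace M]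
  [ChartedSpace (EuclideanSpace ℝ (Fin n)) M] [IsManifold (𝓡 n) ∞ M]
  [MeasurableSpace M] [BorelSpace M]

theorem volumeMeasure_eq_withDensity {g : SymTensorField n M} (hg : g ∈ Metrics n M)
    (k : SymTensorField n M) :
    volumeMeasure k =
      (volumeMeasure g).withDensity fun x => ENNReal.ofReal (volumeDensity g k x) := by
  rw [volumeMeasure, volumeMeasure, withDensity_sum]
  congr 1
  funext x₀
  have hρ : Measurable fun x => ENNReal.ofReal (chartPartition n M x₀ x) :=
    (chartPartition n M x₀).contMDiff.continuous.measurable.ennreal_ofReal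
  have hd := measurable_ofReal_volumeDensity hg k
  rw [chartVolume_eq_withDensity hg k x₀, ← withDensity_mul _ hd hρ, ← withDensity_mul _ hρ hd,
    mul_comm]

theorem ebinMetric_eq_integral {g k : SymTensorField n M} (hg : g ∈ Metrics n M)
    (s t : SymTensorField n M) :
    ebinMetric k s t =
      ∫ x, traceProduct k s t x * volumeDensity g k x ∂(volumeMeasure g) := by
  rw [ebinMetric, volumeMeasure_eq_withDensity hg k,
    integral_withDensity_eq_integral_toReal_smul (measurable_ofReal_volumeDensity hg k) (by simp)]
  refine integral_congr_ae (ae_of_all _ fun x => ?_)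
  have h0 := volumeDensity_nonneg g k x
  simp only [smul_eq_mul, ENNReal.toReal_ofReal h0, mul_comm]

theorem totalVolume_eq_integral {g : SymTensorField n M} (hg : g ∈ Metrics n M)
    (k : SymTensorField n M) :
    totalVolume k = ∫ x, volumeDensity g k x ∂(volumeMeasure g) := by
  rw [totalVolume, volumeMeasure_eq_withDensity hg k, withDensity_apply _ MeasurableSet.univ,
    Measure.restrict_univ, integral_eq_lintegral_of_nonneg_ae
      (ae_of_all _ (volumeDensity_nonneg g k))
      (continuous_volumeDensity hg k).measurable.aestronglyMeasurable]

/-- The density of `dV_k` with respect to `dV_g` is everywhere positive. Positivity of the volume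
thus passes from the starting point of a path to all of its points. -/
theorem totalVolume_pos {g k : SymTensorField n M} (hg : g ∈ Metrics n M)
    (hV : 0 < totalVolume g) (hk : k ∈ Metrics n M) : 0 < totalVolume k := by
  have := isFiniteMeasure_volumeMeasure hV
  have hne : NeZero (volumeMeasure g) := ⟨fun h => by simp [totalVolume, h] at hV⟩
  rw [totalVolume_eq_integral hg, integral_pos_iff_support_of_nonneg
    (fun x => (volumeDensity_pos hg hk x).le) (integrable_of_continuous (continuous_volumeDensity hg k))]
  have : Function.support (volumeDensity g k) = univ :=
    eq_univ_of_forall fun x => (volumeDensity_pos hg hk x).ne'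
  rw [this]
  exact Measure.measure_univ_pos.2 hne.out

section Curve

variable {γ γ' : ℝ → SymTensorField n M} {a b : ℝ} {g : SymTensorField n M}

theorem IsC1CurveOn.continuousOn_totalVolume (h : IsC1CurveOn γ γ' a b) (hg : g ∈ Metrics n M)
    (hV : 0 < totalVolume g) : ContinuousOn (fun t => totalVolume (γ t)) (Icc a b) := by
  have := isFiniteMeasure_volumeMeasure hV
  simp only [totalVolume_eq_integral hg]
  exact continuousOn_integral_of_continuousOn_prod
    (h.jointlyContinuousOn.continuousOn_volumeDensity hg)

theorem IsC1CurveOn.continuousOn_ebinMetric (h : IsC1CurveOn γ γ' a b)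
    (hm : ∀ t ∈ Icc a b, γ t ∈ Metrics n M) (hg : g ∈ Metrics n M) (hV : 0 < totalVolume g) :
    ContinuousOn (fun t => ebinMetric (γ t) (γ' t) (γ' t)) (Icc a b) := by
  have := isFiniteMeasure_volumeMeasure hV
  simp only [ebinMetric_eq_integral hg]
  have hγ' := JointlyContinuousOn.of_continuousOn h.2
  exact continuousOn_integral_of_continuousOn_prod
    ((h.jointlyContinuousOn.continuousOn_traceProduct hγ' hγ' hm).mul
      (h.jointlyContinuousOn.continuousOn_volumeDensity hg))

theorem IsC1CurveOn.hasDerivAt_totalVolume (h : IsC1CurveOn γ γ' a b)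
    (hm : ∀ t ∈ Icc a b, γ t ∈ Metrics n M) (hg : g ∈ Metrics n M) (hV : 0 < totalVolume g)
    {t : ℝ} (ht : t ∈ Ioo a b) :
    HasDerivAt (fun s => totalVolume (γ s))
      (∫ x, traceWith (γ t) (γ' t) x * volumeDensity g (γ t) x / 2 ∂(volumeMeasure g)) t := by
  have := isFiniteMeasure_volumeMeasure hV
  simp only [totalVolume_eq_integral hg]
  have hc : ContinuousOn (fun q : ℝ × M =>
      traceWith (γ q.1) (γ' q.1) q.2 * volumeDensity g (γ q.1) q.2 / 2) (Icc a b ×ˢ univ) :=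
    ((h.jointlyContinuousOn.continuousOn_traceWith (.of_continuousOn h.2) hm).mul
      (h.jointlyContinuousOn.continuousOn_volumeDensity hg)).div_const 2
  -- The maximum over the compact set `[a, b] × M` is the dominating constant for differentiation
  -- under the integral.
  obtain ⟨C, hC⟩ := (isCompact_Icc.prod isCompact_univ).exists_bound_of_continuousOn hc
  refine (hasDerivAt_integral_of_dominated_loc_of_deriv_le (bound := fun _ => C)
    (F' := fun t x => traceWith (γ t) (γ' t) x * volumeDensity g (γ t) x / 2)
    (Ioo_mem_nhds ht.1 ht.2) ?_ ?_ ?_ ?_ (integrable_const C) ?_).2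
  · exact Eventually.of_forall fun s =>
      (continuous_volumeDensity hg (γ s)).measurable.aestronglyMeasurable
  · exact integrable_of_continuous (continuous_volumeDensity hg _)
  · exact (continuous_of_continuousOn_prod_univ hc
      (Ioo_subset_Icc_self ht)).measurable.aestronglyMeasurable
  · exact ae_of_all _ fun x s hs => hC (s, x) ⟨Ioo_subset_Icc_self hs, mem_univ x⟩
  · exact ae_of_all _ fun x s hs =>
      (h.hasDerivWithinAt_volumeDensity hm (Ioo_subset_Icc_self hs) hg x).hasDerivAt
        (Icc_mem_nhds hs.1 hs.2)

/-- The first variation of the volume is controlled by the Ebin norm. -/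
theorem integral_traceWith_sq_le {k : SymTensorField n M} (hg : g ∈ Metrics n M)
    (hV : 0 < totalVolume g) (hk : k ∈ Metrics n M) (s : SymTensorField n M) :
    (∫ x, traceWith k s x * volumeDensity g k x ∂(volumeMeasure g)) ^ 2 ≤
      n * (totalVolume k * ebinMetric k s s) := by
  have := isFiniteMeasure_volumeMeasure hV
  have hd := continuous_volumeDensity hg k
  have hkS : ∀ t ∈ (univ : Set ℝ), (fun _ : ℝ => k) t ∈ Metrics n M := fun _ _ => hk
  have hf : Continuous (traceWith k s) := continuous_of_continuousOn_prod_univ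
    ((JointlyContinuousOn.const k univ).continuousOn_traceWith (.const s univ) hkS) (mem_univ 0)
  have hp : Continuous (traceProduct k s s) := continuous_of_continuousOn_prod_univ
    ((JointlyContinuousOn.const k univ).continuousOn_traceProduct (.const s univ) (.const s univ)
      hkS) (mem_univ 0)
  have hVk := totalVolume_pos hg hV hk
  rw [ebinMetric_eq_integral hg]
  rw [totalVolume_eq_integral hg] at hVk ⊢
  set μ := volumeMeasure g
  set V := ∫ x, volumeDensity g k x ∂μ
  set J := ∫ x, traceWith k s x * volumeDensity g k x ∂μ
  have i1 : Integrable (fun x => traceWith k s x * volumeDensity g k x) μ :=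
    integrable_of_continuous (hf.mul hd)
  have i2 : Integrable (fun x => traceWith k s x ^ 2 * volumeDensity g k x) μ :=
    integrable_of_continuous ((hf.pow 2).mul hd)
  have i3 : Integrable (fun x => volumeDensity g k x) μ := integrable_of_continuous hd
  -- Cauchy–Schwarz in the form of a nonnegative variance: `J / V` is the mean of the trace for
  -- `dV_k`, and expanding the square gives `J² / V ≤ ∫ tr² dV_k`.
  have hnn : 0 ≤ ∫ x, (traceWith k s x - J / V) ^ 2 * volumeDensity g k x ∂μ :=
    integral_nonneg fun x => mul_nonneg (sq_nonneg _) (Real.sqrt_nonneg _)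
  have hexp : ∫ x, (traceWith k s x - J / V) ^ 2 * volumeDensity g k x ∂μ =
      (∫ x, traceWith k s x ^ 2 * volumeDensity g k x ∂μ) - 2 * (J / V) * J + (J / V) ^ 2 * V := by
    have i4 : Integrable (fun x => traceWith k s x ^ 2 * volumeDensity g k x -
        2 * (J / V) * (traceWith k s x * volumeDensity g k x)) μ := i2.sub (i1.const_mul _)
    rw [← integral_const_mul, ← integral_const_mul, ← integral_sub i2 (i1.const_mul _),
      ← integral_add i4 (i3.const_mul _)]
    exact integral_congr_ae (ae_of_all _ fun x => by ring)
  have hle : ∫ x, traceWith k s x ^ 2 * volumeDensity g k x ∂μ ≤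
      n * ∫ x, traceProduct k s s x * volumeDensity g k x ∂μ := by
    rw [← integral_const_mul]
    refine integral_mono i2 ((integrable_of_continuous (hp.mul hd)).const_mul _) fun x => ?_
    rw [← mul_assoc]
    exact mul_le_mul_of_nonneg_right (traceWith_sq_le hk s x) (Real.sqrt_nonneg _)
  rw [hexp] at hnn
  have h1 : J ^ 2 / V ≤ ∫ x, traceWith k s x ^ 2 * volumeDensity g k x ∂μ := by
    have : 2 * (J / V) * J - (J / V) ^ 2 * V = J ^ 2 / V := by field_simp; ring
    linarith
  rw [div_le_iff₀ hVk] at h1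
  nlinarith [mul_le_mul_of_nonneg_right hle hVk.le]

end Curve

end Volume

end MetricSpaceOfMetrics

/-! ### Monotonicity estimates for real powers -/

theorem Real.rpow_le_max_rpow {a b x : ℝ} (ha : 0 < a) (hx : x ∈ Icc a b) (r : ℝ) :
    x ^ r ≤ max (a ^ r) (b ^ r) := by
  have hx0 := ha.trans_le hx.1
  rcases le_total 0 r with hr | hr
  · exact le_max_of_le_right (Real.rpow_le_rpow hx0.le hx.2 hr)
  · exact le_max_of_le_left (Real.rpow_le_rpow_of_nonpos ha hx.1 hr)

/-- For `e ≠ 0` the power `x ^ e` is strictly monotone, so leaving `[a, d]` from `[b, c]` crosses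
`[a, b]` or `[c, d]`; `δ` is the smaller of the two changes. -/
theorem Real.exists_pos_le_abs_rpow_sub_rpow {a b c d e : ℝ} (ha : 0 < a) (hab : a < b)
    (hcd : c < d) (hbc : b ≤ c) (he : e ≠ 0) :
    ∃ δ > 0, ∀ u ∈ Icc b c, ∀ w, 0 < w → w ∉ Icc a d → δ ≤ |w ^ e - u ^ e| := by
  have hb := ha.trans hab
  have hc := hb.trans_le hbc
  have hd := hc.trans hcd
  rcases he.lt_or_gt with he | he
  · have h1 := Real.rpow_lt_rpow_of_neg ha hab he
    have h2 := Real.rpow_lt_rpow_of_neg hc hcd he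
    refine ⟨min (a ^ e - b ^ e) (c ^ e - d ^ e), by simp [h1, h2], fun u hu w hw hwm => ?_⟩
    have hu0 := hb.trans_le hu.1
    have k1 := Real.rpow_le_rpow_of_nonpos hb hu.1 he.le
    have k2 := Real.rpow_le_rpow_of_nonpos hu0 hu.2 he.le
    rcases lt_or_ge w a with h | h
    · have := Real.rpow_lt_rpow_of_neg hw h he
      exact (min_le_left _ _).trans (le_abs.2 (Or.inl (by linarith)))
    · have hdw : d < w := not_le.1 fun h' => hwm ⟨h, h'⟩
      have := Real.rpow_lt_rpow_of_neg hd hdw he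
      exact (min_le_right _ _).trans (le_abs.2 (Or.inr (by linarith)))
  · have h1 := Real.rpow_lt_rpow ha.le hab he
    have h2 := Real.rpow_lt_rpow hc.le hcd he
    refine ⟨min (b ^ e - a ^ e) (d ^ e - c ^ e), by simp [h1, h2], fun u hu w hw hwm => ?_⟩
    have hu0 := hb.trans_le hu.1
    have k1 := Real.rpow_le_rpow hb.le hu.1 he.le
    have k2 := Real.rpow_le_rpow hu0.le hu.2 he.le
    rcases lt_or_ge w a with h | h
    · have := Real.rpow_lt_rpow hw.le h he
      exact (min_le_left _ _).trans (le_abs.2 (Or.inr (by linarith)))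
    · have hdw : d < w := not_le.1 fun h' => hwm ⟨h, h'⟩
      have := Real.rpow_lt_rpow hd.le hdw he
      exact (min_le_right _ _).trans (le_abs.2 (Or.inl (by linarith)))

namespace MetricSpaceOfMetrics

/-! ### Comparison of lengths and the Lipschitz estimate for powers of the volume -/

section Paths

variable {n : ℕ} {M : Type*} [TopologicalSpace M]
  [ChartedSpace (EuclideanSpace ℝ (Fin n)) M] [IsManifold (𝓡 n) ∞ M] {g h : SymTensorField n M}

namespace PiecewiseC1Path

theorem node_le (γ : PiecewiseC1Path g h) {k : ℕ} (hk : k ≤ γ.pieces) :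
    γ.node 0 ≤ γ.node k ∧ γ.node k ≤ γ.node γ.pieces := by
  constructor
  · induction k with
    | zero => exact le_rfl
    | succ k ih => exact (ih (by lia)).trans (γ.node_lt k (by lia)).le
  · induction hk using Nat.decreasingInduction with
    | of_succ k hk ih => exact (γ.node_lt k hk).le.trans ih
    | self => exact le_rfl

theorem length_le_mul_length (γ : PiecewiseC1Path g h)
    {G G' : SymTensorField n M → SymTensorField n M → SymTensorField n M → ℝ} {K : ℝ}
    (hK : 0 ≤ K) (hG : ∀ t ∈ Icc (γ.node 0) (γ.node γ.pieces), ∀ s,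
      Real.sqrt (G (γ.curve t) s s) ≤ K * Real.sqrt (G' (γ.curve t) s s)) :
    γ.length G ≤ ENNReal.ofReal K * γ.length G' := by
  rw [length, length, Finset.mul_sum]
  refine Finset.sum_le_sum fun i hi => ?_
  have hi := Finset.mem_range.1 hi
  rw [← lintegral_const_mul' _ _ ENNReal.ofReal_ne_top]
  refine setLIntegral_mono' measurableSet_Icc fun t ht => ?_
  rw [← ENNReal.ofReal_mul hK]
  exact ENNReal.ofReal_le_ofReal (hG t
    ⟨(γ.node_le hi.le).1.trans ht.1, ht.2.trans (γ.node_le hi).2⟩ _)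

end PiecewiseC1Path

/-- The ratio of the two metrics is `V^(q-p)`, and a power on `[a, b]` is at most its larger
endpoint value. -/
theorem sqrt_conformalEbinMetric_le [T2Space M] [CompactSpace M] [MeasurableSpace M]
    {k : SymTensorField n M} (hk : k ∈ Metrics n M) {a b : ℝ}
    (ha : 0 < a) (hV : totalVolume k ∈ Icc a b) (p q : ℝ) (s : SymTensorField n M) :
    Real.sqrt (conformalEbinMetric p k s s) ≤
      Real.sqrt (max (a ^ (q - p)) (b ^ (q - p))) * Real.sqrt (conformalEbinMetric q k s s) := by
  have hv := ha.trans_le hV.1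
  have hE := ebinMetric_nonneg hk s
  rw [← Real.sqrt_mul (le_max_of_le_left (Real.rpow_nonneg ha.le _))]
  refine Real.sqrt_le_sqrt ?_
  rw [conformalEbinMetric, conformalEbinMetric, ← mul_assoc]
  refine mul_le_mul_of_nonneg_right ?_ hE
  have : totalVolume k ^ (-p) = totalVolume k ^ (q - p) * totalVolume k ^ (-q) := by
    rw [← Real.rpow_add hv]
    congr 1
    ring
  rw [this]
  exact mul_le_mul_of_nonneg_right (Real.rpow_le_max_rpow ha hV _) (Real.rpow_nonneg hv.le _)

end Paths

section Lipschitz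

variable {n : ℕ} {M : Type*} [TopologicalSpace M] [T2Space M] [CompactSpace M]
  [ChartedSpace (EuclideanSpace ℝ (Fin n)) M] [IsManifold (𝓡 n) ∞ M]
  [MeasurableSpace M] [BorelSpace M]

variable {γ γ' : ℝ → SymTensorField n M} {a b : ℝ} {g : SymTensorField n M}

theorem IsC1CurveOn.continuousOn_speed (h : IsC1CurveOn γ γ' a b)
    (hm : ∀ t ∈ Icc a b, γ t ∈ Metrics n M) (hg : g ∈ Metrics n M) (hV : 0 < totalVolume g)
    (q : ℝ) :
    ContinuousOn (fun t => Real.sqrt (conformalEbinMetric q (γ t) (γ' t) (γ' t))) (Icc a b) :=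
  (((h.continuousOn_totalVolume hg hV).rpow_const
    fun t ht => Or.inl (totalVolume_pos hg hV (hm t ht)).ne').mul
      (h.continuousOn_ebinMetric hm hg hV)).sqrt

/-- A power of the volume is Lipschitz along curves, with respect to the length for `g_q`. -/
theorem IsC1CurveOn.abs_rpow_totalVolume_sub_le (h : IsC1CurveOn γ γ' a b)
    (hm : ∀ t ∈ Icc a b, γ t ∈ Metrics n M) (hg : g ∈ Metrics n M) (hV : 0 < totalVolume g)
    (q : ℝ) {t : ℝ} (ht : t ∈ Icc a b) :
    ENNReal.ofReal |totalVolume (γ t) ^ ((1 - q) / 2) - totalVolume (γ a) ^ ((1 - q) / 2)| ≤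
      ENNReal.ofReal (|(1 - q) / 2| * Real.sqrt n / 2) * ∫⁻ s in Icc a b,
        ENNReal.ofReal (Real.sqrt (conformalEbinMetric q (γ s) (γ' s) (γ' s))) := by
  set e := (1 - q) / 2 with he
  set σ : ℝ → ℝ := fun s => Real.sqrt (conformalEbinMetric q (γ s) (γ' s) (γ' s)) with hσ
  set c := |e| * Real.sqrt n / 2 with hc
  have hc0 : 0 ≤ c := by positivity
  have hpos : ∀ s ∈ Icc a b, 0 < totalVolume (γ s) := fun s hs => totalVolume_pos hg hV (hm s hs)
  have hsub : Icc a t ⊆ Icc a b := Icc_subset_Icc_right ht.2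
  have hσc : ContinuousOn σ (Icc a t) := (h.continuousOn_speed hm hg hV q).mono hsub
  have hΦc : ContinuousOn (fun s => totalVolume (γ s) ^ e) (Icc a t) :=
    ((h.continuousOn_totalVolume hg hV).mono hsub).rpow_const
      fun s hs => Or.inl (hpos s (hsub hs)).ne'
  set Φ' : ℝ → ℝ := fun s => (∫ x, traceWith (γ s) (γ' s) x * volumeDensity g (γ s) x / 2
    ∂(volumeMeasure g)) * e * totalVolume (γ s) ^ (e - 1) with hΦ'
  have hder : ∀ s ∈ Ioo a t, HasDerivAt (fun s => totalVolume (γ s) ^ e) (Φ' s) s :=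
    fun s hs => by
      have hs' : s ∈ Ioo a b := ⟨hs.1, hs.2.trans_le ht.2⟩
      exact (h.hasDerivAt_totalVolume hm hg hV hs').rpow_const
        (Or.inl (hpos s (Ioo_subset_Icc_self hs')).ne')
  have hbound : ∀ s ∈ Ioo a t, |Φ' s| ≤ c * σ s := fun s hs => by
    have hs' : s ∈ Icc a b := hsub (Ioo_subset_Icc_self hs)
    have hv := hpos s hs'
    have hE := ebinMetric_nonneg (hm s hs') (γ' s)
    have key := integral_traceWith_sq_le hg hV (hm s hs') (γ' s)
    simp only [hΦ', integral_div]
    set J := ∫ x, traceWith (γ s) (γ' s) x * volumeDensity g (γ s) x ∂(volumeMeasure g)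
    have hJ : |J| ≤ Real.sqrt n * (Real.sqrt (totalVolume (γ s)) *
        Real.sqrt (ebinMetric (γ s) (γ' s) (γ' s))) := by
      rw [← Real.sqrt_mul hv.le, ← Real.sqrt_mul (Nat.cast_nonneg n)]
      exact Real.abs_le_sqrt key
    have hσs : σ s = totalVolume (γ s) ^ (-q / 2) *
        Real.sqrt (ebinMetric (γ s) (γ' s) (γ' s)) := by
      rw [hσ]
      simp only [conformalEbinMetric]
      rw [Real.sqrt_mul (Real.rpow_nonneg hv.le _), Real.sqrt_eq_rpow (_ ^ (-q)),
        ← Real.rpow_mul hv.le]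
      ring_nf
    -- This identity dictates `e = (1 - q) / 2`: the volume factor from the chain rule, times the
    -- `√V` from Cauchy–Schwarz, is exactly the weight of `g_q`.
    have hpow : totalVolume (γ s) ^ (e - 1) * Real.sqrt (totalVolume (γ s)) =
        totalVolume (γ s) ^ (-q / 2) := by
      rw [Real.sqrt_eq_rpow, ← Real.rpow_add hv]
      congr 1
      rw [he]
      ring
    have hp0 : 0 ≤ totalVolume (γ s) ^ (e - 1) := Real.rpow_nonneg hv.le _
    rw [abs_mul, abs_mul, abs_of_nonneg hp0, abs_div, abs_two, hσs, ← hpow, hc]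
    calc |J| / 2 * |e| * totalVolume (γ s) ^ (e - 1)
        = |J| * (|e| / 2 * totalVolume (γ s) ^ (e - 1)) := by ring
      _ ≤ Real.sqrt n * (Real.sqrt (totalVolume (γ s)) *
        Real.sqrt (ebinMetric (γ s) (γ' s) (γ' s))) * (|e| / 2 * totalVolume (γ s) ^ (e - 1)) :=
          mul_le_mul_of_nonneg_right hJ (by positivity)
      _ = _ := by ring
  have hint : IntegrableOn (fun s => c * σ s) (Icc a t) :=
    (hσc.const_mul c).integrableOn_compact isCompact_Icc
  -- Bounding the increments of `Φ` and `-Φ` separately requires integrability of the bound `c * σ`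
  -- only, not of `Φ'`.
  have hup := intervalIntegral.sub_le_integral_of_hasDeriv_right_of_le ht.1 hΦc
    (fun s hs => (hder s hs).hasDerivWithinAt) hint
    (fun s hs => (le_abs_self _).trans (hbound s hs))
  have hlow := intervalIntegral.sub_le_integral_of_hasDeriv_right_of_le ht.1 hΦc.neg
    (fun s hs => (hder s hs).neg.hasDerivWithinAt) hint
    (fun s hs => (neg_le_abs _).trans (hbound s hs))
  have habs : |totalVolume (γ t) ^ e - totalVolume (γ a) ^ e| ≤ c * ∫ s in Ioc a t, σ s := by
    rw [intervalIntegral.integral_of_le ht.1, integral_const_mul] at hup hlow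
    simp only [Pi.neg_apply] at hlow
    exact abs_le.2 ⟨by linarith, by linarith⟩
  refine (ENNReal.ofReal_le_ofReal habs).trans ?_
  rw [ENNReal.ofReal_mul hc0, ofReal_integral_eq_lintegral_ofReal
    ((hσc.integrableOn_compact isCompact_Icc).mono_set Ioc_subset_Icc_self)
    (ae_of_all _ fun s => Real.sqrt_nonneg _)]
  gcongr
  exact Ioc_subset_Icc_self.trans hsub

namespace PiecewiseC1Path

variable {h : SymTensorField n M}

theorem abs_rpow_totalVolume_sub_le (γ : PiecewiseC1Path g h) (hg : g ∈ Metrics n M)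
    (hV : 0 < totalVolume g) (q : ℝ) {t : ℝ} (ht : t ∈ Icc (γ.node 0) (γ.node γ.pieces)) :
    ENNReal.ofReal |totalVolume (γ.curve t) ^ ((1 - q) / 2) - totalVolume g ^ ((1 - q) / 2)| ≤
      ENNReal.ofReal (|(1 - q) / 2| * Real.sqrt n / 2) *
        γ.length (conformalEbinMetric q) := by
  -- For the induction, a time inside the last piece is charged the whole length of that piece.
  suffices H : ∀ k ≤ γ.pieces, ∀ t ∈ Icc (γ.node 0) (γ.node k),
      ENNReal.ofReal |totalVolume (γ.curve t) ^ ((1 - q) / 2) - totalVolume g ^ ((1 - q) / 2)| ≤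
      ENNReal.ofReal (|(1 - q) / 2| * Real.sqrt n / 2) *
        ∑ i ∈ Finset.range k, ∫⁻ t in Icc (γ.node i) (γ.node (i + 1)), ENNReal.ofReal
          (Real.sqrt (conformalEbinMetric q (γ.curve t) (γ.velocity i t) (γ.velocity i t))) from
    H _ le_rfl t ht
  intro k
  induction k with
  | zero =>
    intro _ t ht
    have : t = γ.node 0 := le_antisymm ht.2 ht.1
    simp [this, γ.start_eq]
  | succ k ih =>
    intro hk t ht
    rw [Finset.sum_range_succ, mul_add]
    rcases le_total t (γ.node k) with htk | htk
    · exact (ih (by lia) t ⟨ht.1, htk⟩).trans le_self_add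
    · have hm : ∀ s ∈ Icc (γ.node k) (γ.node (k + 1)), γ.curve s ∈ Metrics n M := fun s hs =>
        γ.mem_metrics s ⟨(γ.node_le (by lia)).1.trans hs.1, hs.2.trans (γ.node_le hk).2⟩
      have h1 := ih (by lia) (γ.node k) ⟨(γ.node_le (by lia)).1, le_rfl⟩
      have h2 := (γ.isC1 k (by lia)).abs_rpow_totalVolume_sub_le hm hg hV q ⟨htk, ht.2⟩
      refine le_trans ?_ (add_le_add h1 h2)
      rw [← ENNReal.ofReal_add (abs_nonneg _) (abs_nonneg _), add_comm]
      exact ENNReal.ofReal_le_ofReal (abs_sub_le _ _ _)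

end PiecewiseC1Path

end Lipschitz

end MetricSpaceOfMetrics

namespace MetricSpaceOfMetrics

/-! ### Straight segments and polygonal paths of metrics -/

section Polylines

variable {n : ℕ} {M : Type*} [TopologicalSpace M]
  [ChartedSpace (EuclideanSpace ℝ (Fin n)) M] [IsManifold (𝓡 n) ∞ M]

theorem smul_mem_metrics {g : SymTensorField n M} (hg : g ∈ Metrics n M) {c : ℝ} (hc : 0 < c) :
    c • g ∈ Metrics n M := fun x u hu => by
  rw [SymTensorField.val_smul]
  exact mul_pos hc (hg x u hu)

theorem segment_mem_metrics {g h : SymTensorField n M} (hg : g ∈ Metrics n M)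
    (hh : h ∈ Metrics n M) {t : ℝ} (ht : t ∈ Icc (0 : ℝ) 1) : g + t • (h - g) ∈ Metrics n M :=
  fun x u hu => by
    have h1 := hg x u hu
    have h2 := hh x u hu
    simp only [SymTensorField.val_add, SymTensorField.val_smul, SymTensorField.val_sub]
    have : g.val x u u + t * (h.val x u u - g.val x u u) =
      (1 - t) * g.val x u u + t * h.val x u u := by ring
    rw [this]
    rcases ht.1.eq_or_lt with rfl | h0
    · simpa using h1
    · exact add_pos_of_nonneg_of_pos (mul_nonneg (sub_nonneg.2 ht.2) h1.le) (mul_pos h0 h2)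

theorem isC1CurveOn_of_eqOn_affine {γ : ℝ → SymTensorField n M} {a b c : ℝ}
    (k s : SymTensorField n M) (h : ∀ t ∈ Icc a b, γ t = k + (t - c) • s) :
    IsC1CurveOn γ (fun _ => s) a b := by
  refine ⟨fun t ht => tendsto_const_nhds.congr' ?_, continuousOn_const⟩
  filter_upwards [self_mem_nhdsWithin] with r hr
  have hne : r - t ≠ 0 := sub_ne_zero.2 hr.2
  rw [h r hr.1, h t ht, add_sub_add_left_eq_sub, ← sub_smul, sub_sub_sub_cancel_right, smul_smul,
    inv_mul_cancel₀ hne, one_smul]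

/-- The length of the straight segment from `g` to `h`. -/
noncomputable def segmentLength (G : SymTensorField n M → SymTensorField n M → SymTensorField n M → ℝ)
    (g h : SymTensorField n M) : ℝ≥0∞ :=
  ∫⁻ t in Icc (0 : ℝ) 1, ENNReal.ofReal (Real.sqrt (G (g + t • (h - g)) (h - g) (h - g)))

/-- The polygonal line through the points `P 0, P 1, …`, parametrized so that it passes through
`P i` at time `i`. -/
noncomputable def polyline (P : ℕ → SymTensorField n M) (t : ℝ) : SymTensorField n M :=
  P ⌊t⌋₊ + (t - ⌊t⌋₊) • (P (⌊t⌋₊ + 1) - P ⌊t⌋₊)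

theorem polyline_eq (P : ℕ → SymTensorField n M) {i : ℕ} {t : ℝ}
    (ht : t ∈ Icc (i : ℝ) ((i + 1 : ℕ) : ℝ)) :
    polyline P t = P i + (t - i) • (P (i + 1) - P i) := by
  -- At the right end the floor jumps to `i + 1`, and both formulas give `P (i + 1)`.
  rcases ht.2.eq_or_lt with rfl | h
  · rw [polyline, Nat.floor_natCast]
    simp
  · have : ⌊t⌋₊ = i := (Nat.floor_eq_iff ((Nat.cast_nonneg i).trans ht.1)).2
      ⟨ht.1, by simpa using h⟩
    rw [polyline, this]

/-- The polygonal line through `P 0, …, P m` as a path of metrics. -/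
noncomputable def polylinePath (P : ℕ → SymTensorField n M) (hP : ∀ i, P i ∈ Metrics n M) (m : ℕ) :
    PiecewiseC1Path (P 0) (P m) where
  pieces := m
  node i := i
  curve := polyline P
  velocity i _ := P (i + 1) - P i
  node_lt i _ := by simp
  start_eq := by simp [polyline]
  end_eq := by simp [polyline]
  mem_metrics t ht := by
    have h0 : 0 ≤ t := by simpa using ht.1
    exact segment_mem_metrics (hP _) (hP _)
      ⟨sub_nonneg.2 (Nat.floor_le h0), by linarith [Nat.lt_floor_add_one t]⟩
  isC1 i _ := isC1CurveOn_of_eqOn_affine (P i) _ fun _ ht => polyline_eq P ht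

theorem lintegral_Icc_sub_natCast (f : ℝ → ℝ≥0∞) (i : ℕ) :
    ∫⁻ t in Icc (i : ℝ) ((i + 1 : ℕ) : ℝ), f (t - i) = ∫⁻ t in Icc (0 : ℝ) 1, f t := by
  rw [← lintegral_indicator measurableSet_Icc, ← lintegral_indicator measurableSet_Icc,
    ← lintegral_sub_right_eq_self ((Icc (0 : ℝ) 1).indicator f) (i : ℝ)]
  congr 1
  funext t
  simp only [indicator, mem_Icc, Nat.cast_add, Nat.cast_one, sub_nonneg, sub_le_iff_le_add,
    add_comm (1 : ℝ)]

theorem length_polylinePath (P : ℕ → SymTensorField n M) (hP : ∀ i, P i ∈ Metrics n M) (m : ℕ)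
    (G : SymTensorField n M → SymTensorField n M → SymTensorField n M → ℝ) :
    (polylinePath P hP m).length G =
      ∑ i ∈ Finset.range m, segmentLength G (P i) (P (i + 1)) := by
  refine Finset.sum_congr rfl fun i _ => ?_
  rw [segmentLength, ← lintegral_Icc_sub_natCast _ i]
  refine setLIntegral_congr_fun measurableSet_Icc fun t ht => ?_
  have : (polylinePath P hP m).curve t = P i + (t - i) • (P (i + 1) - P i) := polyline_eq P ht
  simp only [this]
  rfl

end Polylines

/-! ### Behaviour under homotheties -/

section Scaling

variable {n : ℕ} {M : Type*} [TopologicalSpace M]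
  [ChartedSpace (EuclideanSpace ℝ (Fin n)) M] [IsManifold (𝓡 n) ∞ M]

theorem inv_matrixAt_smul (k : SymTensorField n M) {c : ℝ} (hc : c ≠ 0) (x : M)
    (hk : k ∈ Metrics n M) : (matrixAt (c • k) x)⁻¹ = c⁻¹ • (matrixAt k x)⁻¹ := by
  rw [matrixAt_smul]
  exact Matrix.inv_smul' _ (Units.mk0 c hc) (isUnit_iff_ne_zero.2 (det_matrixAt_pos hk x).ne')

theorem traceProduct_smul {k : SymTensorField n M} (hk : k ∈ Metrics n M) {c : ℝ} (hc : c ≠ 0)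
    (s t : SymTensorField n M) (x : M) :
    traceProduct (c • k) s t x = (c ^ 2)⁻¹ * traceProduct k s t x := by
  rw [traceProduct, inv_matrixAt_smul k hc x hk]
  simp only [Matrix.smul_mul, Matrix.mul_smul, Matrix.trace_smul, smul_smul, smul_eq_mul]
  rw [traceProduct, sq, mul_inv]

theorem traceProduct_smul_smul (k s t : SymTensorField n M) (c : ℝ) (x : M) :
    traceProduct k (c • s) (c • t) x = c ^ 2 * traceProduct k s t x := by
  rw [traceProduct, matrixAt_smul, matrixAt_smul]
  simp only [Matrix.smul_mul, Matrix.mul_smul, Matrix.trace_smul, smul_smul, smul_eq_mul]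
  rw [traceProduct, sq]

theorem traceProduct_self {g : SymTensorField n M} (hg : g ∈ Metrics n M) (x : M) :
    traceProduct g g g x = n := by
  have hd : IsUnit (matrixAt g x).det := isUnit_iff_ne_zero.2 (det_matrixAt_pos hg x).ne'
  rw [traceProduct, Matrix.nonsing_inv_mul _ hd, Matrix.one_mul, Matrix.nonsing_inv_mul _ hd,
    Matrix.trace_one, Fintype.card_fin]

theorem volumeDensity_smul (g k : SymTensorField n M) {c : ℝ} (hc : 0 < c) (x : M) :
    volumeDensity g (c • k) x = c ^ (n / 2 : ℝ) * volumeDensity g k x := by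
  rw [volumeDensity, matrixAt_smul, Matrix.det_smul, Fintype.card_fin, mul_div_assoc,
    Real.sqrt_mul (by positivity), volumeDensity, Real.sqrt_eq_rpow (c ^ n), ← Real.rpow_natCast,
    ← Real.rpow_mul hc.le]
  ring_nf

variable [T2Space M] [CompactSpace M] [MeasurableSpace M]

theorem ebinMetric_smul_smul (k s : SymTensorField n M) (c : ℝ) :
    ebinMetric k (c • s) (c • s) = c ^ 2 * ebinMetric k s s := by
  simp only [ebinMetric, traceProduct_smul_smul, integral_const_mul]

theorem sqrt_conformalEbinMetric_smul_smul (p : ℝ) (k s : SymTensorField n M) (c : ℝ) :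
    Real.sqrt (conformalEbinMetric p k (c • s) (c • s)) =
      |c| * Real.sqrt (conformalEbinMetric p k s s) := by
  rw [conformalEbinMetric, ebinMetric_smul_smul, mul_left_comm, Real.sqrt_mul (sq_nonneg c),
    Real.sqrt_sq_eq_abs, conformalEbinMetric]

theorem ebinMetric_self {g : SymTensorField n M} (hg : g ∈ Metrics n M) :
    ebinMetric g g g = n * totalVolume g := by
  simp only [ebinMetric, traceProduct_self hg, integral_const, smul_eq_mul, totalVolume,
    Measure.real, mul_comm]

theorem sqrt_conformalEbinMetric_self (p : ℝ) {g : SymTensorField n M} (hg : g ∈ Metrics n M)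
    (hV : 0 < totalVolume g) :
    Real.sqrt (conformalEbinMetric p g g g) = Real.sqrt (n * totalVolume g ^ (1 - p)) := by
  rw [conformalEbinMetric, ebinMetric_self hg, sub_eq_neg_add, Real.rpow_add hV, Real.rpow_one]
  ring_nf

/-- Treating `d_E` as `d_0` makes the two inequalities of the theorem instances of one comparison.
-/
theorem ebinDist_eq_conformalEbinDist_zero (g h : SymTensorField n M) :
    ebinDist g h = conformalEbinDist 0 g h := by
  have : conformalEbinMetric (n := n) (M := M) 0 = ebinMetric := by
    funext g h k
    simp [conformalEbinMetric]
  rw [ebinDist, conformalEbinDist, this]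

variable [BorelSpace M]

theorem totalVolume_smul {k : SymTensorField n M} (hk : k ∈ Metrics n M) {c : ℝ} (hc : 0 < c) :
    totalVolume (c • k) = c ^ (n / 2 : ℝ) * totalVolume k := by
  simp only [totalVolume_eq_integral hk, volumeDensity_smul k k hc, integral_const_mul]

theorem ebinMetric_smul {k : SymTensorField n M} (hk : k ∈ Metrics n M) {c : ℝ} (hc : 0 < c)
    (s : SymTensorField n M) :
    ebinMetric (c • k) s s = (c ^ 2)⁻¹ * c ^ (n / 2 : ℝ) * ebinMetric k s s := by
  rw [ebinMetric_eq_integral hk, ebinMetric_eq_integral hk, ← integral_const_mul]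
  refine integral_congr_ae (ae_of_all _ fun x => ?_)
  simp only [traceProduct_smul hk hc.ne', volumeDensity_smul k k hc]
  ring

/-- The trace contributes `c^(-2)`, the measure `c^(n/2)` and the conformal factor `c^(-np/2)`; the
exponent is half the total. Scaling the tangent vector as well removes the `-1`. -/
theorem sqrt_conformalEbinMetric_smul (p : ℝ) {k : SymTensorField n M} (hk : k ∈ Metrics n M)
    (hV : 0 < totalVolume k) {c : ℝ} (hc : 0 < c) (s : SymTensorField n M) :
    Real.sqrt (conformalEbinMetric p (c • k) s s) =
      c ^ (n * (1 - p) / 4 - 1) * Real.sqrt (conformalEbinMetric p k s s) := by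
  have hpow : (c ^ (n / 2 : ℝ)) ^ (-p) * ((c ^ 2)⁻¹ * c ^ (n / 2 : ℝ)) =
      (c ^ (n * (1 - p) / 4 - 1)) ^ 2 := by
    rw [← Real.rpow_natCast c 2, ← Real.rpow_neg hc.le, ← Real.rpow_mul hc.le,
      ← Real.rpow_add hc, ← Real.rpow_add hc, ← Real.rpow_natCast, ← Real.rpow_mul hc.le]
    congr 1
    push_cast
    ring
  have h0 : 0 ≤ c ^ (n * (1 - p) / 4 - 1) := Real.rpow_nonneg hc.le _
  rw [conformalEbinMetric, totalVolume_smul hk hc, ebinMetric_smul hk hc,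
    Real.mul_rpow (Real.rpow_nonneg hc.le _) hV.le, mul_mul_mul_comm, hpow,
    Real.sqrt_mul (sq_nonneg _), Real.sqrt_sq h0, conformalEbinMetric]

theorem segmentLength_smul_smul (p : ℝ) {g h : SymTensorField n M} (hg : g ∈ Metrics n M)
    (hh : h ∈ Metrics n M) (hV : 0 < totalVolume g) {c : ℝ} (hc : 0 < c) :
    segmentLength (conformalEbinMetric p) (c • g) (c • h) =
      ENNReal.ofReal (c ^ (n * (1 - p) / 4)) * segmentLength (conformalEbinMetric p) g h := by
  rw [segmentLength, segmentLength, ← lintegral_const_mul' _ _ ENNReal.ofReal_ne_top]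
  refine setLIntegral_congr_fun measurableSet_Icc fun t ht => ?_
  have hm := segment_mem_metrics hg hh ht
  have h1 : c • g + t • (c • h - c • g) = c • (g + t • (h - g)) := by
    rw [smul_add, ← smul_sub, smul_comm]
  have h2 : c * c ^ (n * (1 - p) / 4 - 1) = c ^ (n * (1 - p) / 4) := by
    rw [Real.rpow_sub_one hc.ne', mul_div_cancel₀ _ hc.ne']
  rw [h1, ← smul_sub, sqrt_conformalEbinMetric_smul_smul,
    sqrt_conformalEbinMetric_smul p hm (totalVolume_pos hg hV hm) hc, abs_of_pos hc, ← mul_assoc,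
    h2, ENNReal.ofReal_mul (Real.rpow_nonneg hc.le _)]

theorem segmentLength_ne_top (p : ℝ) {g h : SymTensorField n M} (hg : g ∈ Metrics n M)
    (hh : h ∈ Metrics n M) (hV : 0 < totalVolume g) :
    segmentLength (conformalEbinMetric p) g h ≠ ⊤ := by
  have hC : IsC1CurveOn (fun t : ℝ => g + t • (h - g)) (fun _ => h - g) 0 1 :=
    isC1CurveOn_of_eqOn_affine (c := 0) g (h - g) fun t _ => by simp
  have hcont := hC.continuousOn_speed (fun t ht => segment_mem_metrics hg hh ht) hg hV p
  have hint := hcont.integrableOn_compact isCompact_Icc (μ := volume)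
  exact (lintegral_ofReal_le_lintegral_enorm _).trans_lt hint.2 |>.ne

/-- At `r g` the speed is proportional to `r^(α-1)`, with primitive `r^α / α`. Hence a ray has
bounded length towards the end where `r^α → 0`: `r → 0` if `α > 0`, `r → ∞` if `α < 0`. -/
theorem segmentLength_ray (p : ℝ) (hα : (n * (1 - p) / 4 : ℝ) ≠ 0) {g : SymTensorField n M}
    (hg : g ∈ Metrics n M) (hV : 0 < totalVolume g) {a b : ℝ} (ha : 0 < a) (hb : 0 < b) :
    segmentLength (conformalEbinMetric p) (a • g) (b • g) =
      ENNReal.ofReal (|b ^ (n * (1 - p) / 4 : ℝ) - a ^ (n * (1 - p) / 4 : ℝ)| /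
        |(n * (1 - p) / 4 : ℝ)| * Real.sqrt (n * totalVolume g ^ (1 - p))) := by
  set α : ℝ := n * (1 - p) / 4
  set w := Real.sqrt (n * totalVolume g ^ (1 - p)) with hw
  have hr : ∀ t ∈ Icc (0 : ℝ) 1, 0 < a + t * (b - a) := fun t ht => by
    rcases ht.1.eq_or_lt with rfl | h0
    · simpa using ha
    · nlinarith [mul_nonneg (sub_nonneg.2 ht.2) ha.le, mul_pos h0 hb]
  have hcont : ContinuousOn (fun t : ℝ => (a + t * (b - a)) ^ (α - 1)) (Icc 0 1) :=
    ContinuousOn.rpow_const (by fun_prop) fun t ht => Or.inl (hr t ht).ne'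
  have hI : ∫ t in (0 : ℝ)..1, (b - a) * (a + t * (b - a)) ^ (α - 1) = (b ^ α - a ^ α) / α := by
    have hder : ∀ t ∈ uIcc (0 : ℝ) 1, HasDerivAt (fun t : ℝ => (a + t * (b - a)) ^ α / α)
        ((b - a) * (a + t * (b - a)) ^ (α - 1)) t := fun t ht => by
      rw [uIcc_of_le zero_le_one] at ht
      have h1 : HasDerivAt (fun t : ℝ => a + t * (b - a)) (b - a) t := by
        simpa using ((hasDerivAt_id t).mul_const (b - a)).const_add a
      refine ((h1.rpow_const (p := α) (Or.inl (hr t ht).ne')).div_const α).congr_deriv ?_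
      field_simp
    rw [intervalIntegral.integral_eq_sub_of_hasDerivAt hder]
    · simp only [one_mul, zero_mul, add_zero, add_sub_cancel]
      ring
    · refine ContinuousOn.intervalIntegrable ?_
      rw [uIcc_of_le zero_le_one]
      exact hcont.const_mul _
  have hlen : segmentLength (conformalEbinMetric p) (a • g) (b • g) =
      ∫⁻ t in Icc (0 : ℝ) 1, ENNReal.ofReal (|b - a| * (a + t * (b - a)) ^ (α - 1) * w) := by
    refine setLIntegral_congr_fun measurableSet_Icc fun t ht => ?_
    have h1 : a • g + t • (b • g - a • g) = (a + t * (b - a)) • g := by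
      rw [← sub_smul, smul_smul, ← add_smul]
    rw [h1, ← sub_smul, sqrt_conformalEbinMetric_smul_smul,
      sqrt_conformalEbinMetric_smul p hg hV (hr t ht), sqrt_conformalEbinMetric_self p hg hV,
      mul_assoc]
  have hnn : ∀ t ∈ Icc (0 : ℝ) 1, 0 ≤ |b - a| * (a + t * (b - a)) ^ (α - 1) * w := fun t ht =>
    mul_nonneg (mul_nonneg (abs_nonneg _) (Real.rpow_nonneg (hr t ht).le _)) (Real.sqrt_nonneg _)
  rw [hlen, ← ofReal_integral_eq_lintegral_ofReal
    ((((hcont.const_mul _).mul_const _)).integrableOn_compact isCompact_Icc)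
    (ae_restrict_of_forall_mem measurableSet_Icc hnn), integral_mul_const, integral_const_mul]
  congr 2
  rw [integral_Icc_eq_integral_Ioc, ← intervalIntegral.integral_of_le zero_le_one]
  rw [intervalIntegral.integral_const_mul] at hI
  rw [← abs_div, ← hI, abs_mul, abs_of_nonneg (a := ∫ t in (0 : ℝ)..1, _)]
  exact intervalIntegral.integral_nonneg zero_le_one fun t ht => Real.rpow_nonneg (hr t ht).le _

end Scaling

/-! ### Bounded diameter and comparison of the distances -/

section Comparison

variable {n : ℕ} {M : Type*} [TopologicalSpace M] [T2Space M] [CompactSpace M]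
  [ChartedSpace (EuclideanSpace ℝ (Fin n)) M] [IsManifold (𝓡 n) ∞ M]
  [MeasurableSpace M] [BorelSpace M]

/-- `𝓜_{v,v'}` is bounded for `d_p`: two of its metrics can be joined by shrinking (if `p < 1`) or
expanding (if `p > 1`) both of them homothetically. -/
theorem exists_conformalEbinDist_le (hn : n ≠ 0) {p : ℝ} (hp : p ≠ 1) {v v' : ℝ} (hv : 0 < v) :
    ∃ D : ℝ≥0, ∀ g ∈ metricsVolumeBetween n M v v', ∀ h ∈ metricsVolumeBetween n M v v',
      conformalEbinDist p g h ≤ D := by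
  set α : ℝ := n * (1 - p) / 4 with hα
  have hα0 : α ≠ 0 := by
    have : (n : ℝ) ≠ 0 := Nat.cast_ne_zero.2 hn
    have : 1 - p ≠ 0 := sub_ne_zero.2 hp.symm
    positivity
  set W := max (v ^ (1 - p)) (v' ^ (1 - p))
  set R := 1 / |α| * Real.sqrt (n * W)
  refine ⟨(R + 1 + R).toNNReal, fun g hg h hh => ?_⟩
  have hR0 : 0 ≤ R := by positivity
  have hVg := hv.trans hg.2.1
  have hVh := hv.trans hh.2.1
  set L := segmentLength (conformalEbinMetric p) g h with hL
  have hLtop : L ≠ ⊤ := segmentLength_ne_top p hg.1 hh.1 hVg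
  -- The choice is `c^α = 1 / (L + 1)`, which is possible for either sign of `α`. The factor `c`
  -- depends on `g` and `h`, but the resulting bound `R + 1 + R` does not.
  obtain ⟨c, hc, hcα, hcL⟩ : ∃ c : ℝ, 0 < c ∧ c ^ α ≤ 1 ∧ c ^ α * L.toReal ≤ 1 := by
    have hL1 : 0 < L.toReal + 1 := by positivity
    refine ⟨((L.toReal + 1)⁻¹) ^ (1 / α), by positivity, ?_⟩
    rw [← Real.rpow_mul (by positivity), one_div_mul_cancel hα0, Real.rpow_one]
    refine ⟨inv_le_one_of_one_le₀ (by simp), ?_⟩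
    rw [inv_mul_le_iff₀ hL1]
    linarith
  have hcα0 : 0 < c ^ α := Real.rpow_pos_of_pos hc _
  -- The factors `1 •` put the outer legs in the form required by `segmentLength_ray`.
  let P : ℕ → SymTensorField n M
    | 0 => (1 : ℝ) • g
    | 1 => c • g
    | 2 => c • h
    | _ => (1 : ℝ) • h
  have hP : ∀ i, P i ∈ Metrics n M
    | 0 => smul_mem_metrics hg.1 one_pos
    | 1 => smul_mem_metrics hg.1 hc
    | 2 => smul_mem_metrics hh.1 hc
    | _ + 3 => smul_mem_metrics hh.1 one_pos
  have hd : conformalEbinDist p (P 0) (P 3) ≤ _ := iInf_le _ (polylinePath P hP 3)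
  have hP0 : P 0 = g := one_smul ℝ g
  have hP3 : P 3 = h := one_smul ℝ h
  rw [length_polylinePath, hP0, hP3] at hd
  refine hd.trans ?_
  rw [Finset.sum_range_succ, Finset.sum_range_succ, Finset.sum_range_one]
  have hray {k : SymTensorField n M} (hk : k ∈ metricsVolumeBetween n M v v') :
      |c ^ α - 1| / |α| * Real.sqrt (n * totalVolume k ^ (1 - p)) ≤ R := by
    have h1 : |c ^ α - 1| ≤ 1 := abs_le.2 ⟨by linarith, by linarith⟩
    have h2 := Real.rpow_le_max_rpow hv ⟨hk.2.1.le, hk.2.2.le⟩ (1 - p)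
    exact mul_le_mul (div_le_div_of_nonneg_right h1 (abs_nonneg α))
      (Real.sqrt_le_sqrt (mul_le_mul_of_nonneg_left h2 n.cast_nonneg)) (Real.sqrt_nonneg _)
      (by positivity)
  have e1 : segmentLength (conformalEbinMetric p) (P 0) (P 1) ≤ ENNReal.ofReal R := by
    refine (segmentLength_ray p hα0 hg.1 hVg one_pos hc).trans_le (ENNReal.ofReal_le_ofReal ?_)
    rw [Real.one_rpow]
    exact hray hg
  have e3 : segmentLength (conformalEbinMetric p) (P 2) (P 3) ≤ ENNReal.ofReal R := by
    refine (segmentLength_ray p hα0 hh.1 hVh hc one_pos).trans_le (ENNReal.ofReal_le_ofReal ?_)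
    rw [Real.one_rpow, abs_sub_comm]
    exact hray hh
  have e2 : segmentLength (conformalEbinMetric p) (P 1) (P 2) ≤ ENNReal.ofReal 1 := by
    refine (segmentLength_smul_smul p hg.1 hh.1 hVg hc).trans_le ?_
    rw [← hL, ← ENNReal.ofReal_toReal hLtop, ← ENNReal.ofReal_mul hcα0.le]
    exact ENNReal.ofReal_le_ofReal hcL
  refine (add_le_add (add_le_add e1 e2) e3).trans ?_
  rw [← ENNReal.ofReal_add hR0 zero_le_one, ← ENNReal.ofReal_add (by positivity) hR0]
  rfl

/-- A path issuing from `𝓜_{v,v'}` either keeps its volume in `[v/2, 2v']` or is long. -/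
theorem exists_conformalEbinDist_le_mul (hn : n ≠ 0) {p q : ℝ} (hp : p ≠ 1) (hq : q ≠ 1)
    {v v' : ℝ} (hv : 0 < v) (hvv' : v < v') :
    ∃ C : ℝ≥0, ∀ g ∈ metricsVolumeBetween n M v v', ∀ h ∈ metricsVolumeBetween n M v v',
      conformalEbinDist p g h ≤ C * conformalEbinDist q g h := by
  obtain ⟨D, hD⟩ := exists_conformalEbinDist_le (M := M) hn hp (v' := v') hv
  have he : (1 - q) / 2 ≠ 0 := div_ne_zero (sub_ne_zero.2 hq.symm) two_ne_zero
  obtain ⟨δ, hδ0, hδ⟩ := Real.exists_pos_le_abs_rpow_sub_rpow (a := v / 2) (b := v) (c := v')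
    (d := 2 * v') (half_pos hv) (half_lt_self hv) (by linarith) hvv'.le he
  set K := Real.sqrt (max ((v / 2) ^ (q - p)) ((2 * v') ^ (q - p)))
  set c := |(1 - q) / 2| * Real.sqrt n / 2
  -- `K` serves paths with volume in the range and `D * (c / δ)` those that escape. The `+ 1` makes
  -- the constant nonzero, so that it can be moved inside the infimum even when the infimum is `⊤`.
  refine ⟨K.toNNReal + D * (c / δ).toNNReal + 1, fun g hg h hh => ?_⟩
  have hVg := hv.trans hg.2.1
  rw [conformalEbinDist, conformalEbinDist, riemannianDist, riemannianDist,
    ENNReal.mul_iInf_of_ne (by simp) ENNReal.coe_ne_top]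
  refine le_iInf fun γ => ?_
  by_cases hγ : ∀ t ∈ Icc (γ.node 0) (γ.node γ.pieces),
      totalVolume (γ.curve t) ∈ Icc (v / 2) (2 * v')
  · calc ⨅ γ : PiecewiseC1Path g h, γ.length (conformalEbinMetric p)
        ≤ γ.length (conformalEbinMetric p) := iInf_le _ γ
      _ ≤ ENNReal.ofReal K * γ.length (conformalEbinMetric q) :=
          γ.length_le_mul_length (Real.sqrt_nonneg _) fun t ht s =>
            sqrt_conformalEbinMetric_le (γ.mem_metrics t ht) (half_pos hv) (hγ t ht) p q s
      _ ≤ _ := by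
          gcongr
          push_cast
          rw [add_assoc]
          exact le_self_add
  · push Not at hγ
    obtain ⟨t, ht, htV⟩ := hγ
    have hlong := γ.abs_rpow_totalVolume_sub_le hg.1 hVg q ht
    have hδle := hδ _ ⟨hg.2.1.le, hg.2.2.le⟩ _
      (totalVolume_pos hg.1 hVg (γ.mem_metrics t ht)) htV
    -- The Lipschitz estimate gives `δ ≤ c * length`, which turns the absolute bound `D` into a
    -- multiple of the length.
    have h1 : (1 : ℝ≥0∞) ≤ ENNReal.ofReal (c / δ) * γ.length (conformalEbinMetric q) := by
      have := (ENNReal.ofReal_le_ofReal hδle).trans hlong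
      rw [ENNReal.ofReal_div_of_pos hδ0, div_eq_mul_inv, mul_right_comm, ← div_eq_mul_inv]
      rwa [ENNReal.le_div_iff_mul_le (by simp [hδ0]) (by simp), one_mul]
    calc ⨅ γ : PiecewiseC1Path g h, γ.length (conformalEbinMetric p)
        ≤ D := hD g hg h hh
      _ = D * 1 := (mul_one _).symm
      _ ≤ D * (ENNReal.ofReal (c / δ) * γ.length (conformalEbinMetric q)) := by gcongr
      _ = D * ENNReal.ofReal (c / δ) * γ.length (conformalEbinMetric q) := (mul_assoc _ _ _).symm
      _ ≤ _ := by
          gcongr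
          push_cast
          exact le_add_right le_add_self

end Comparison

/-! ### The zero-dimensional case -/

section DimensionZero

variable {M : Type*} [TopologicalSpace M]
  [ChartedSpace (EuclideanSpace ℝ (Fin 0)) M] [IsManifold (𝓡 0) ∞ M]

theorem mem_metrics_of_dim_zero (g : SymTensorField 0 M) : g ∈ Metrics 0 M := fun _ u hu =>
  absurd (Subsingleton.elim (α := EuclideanSpace ℝ (Fin 0)) u 0) hu

/-- All tensor fields coincide, and the path with no pieces has length zero. -/
theorem riemannianDist_of_dim_zero
    (G : SymTensorField 0 M → SymTensorField 0 M → SymTensorField 0 M → ℝ)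
    (g h : SymTensorField 0 M) : riemannianDist G g h = 0 := by
  have hgh : g = h := Subtype.ext <| ContMDiffSection.ext fun x =>
    ContinuousLinearMap.ext fun u => by
      rw [Subsingleton.elim (α := EuclideanSpace ℝ (Fin 0)) u 0]
      exact ((Subtype.val g : TensorField02 0 M) x).map_zero.trans
        ((Subtype.val h : TensorField02 0 M) x).map_zero.symm
  subst hgh
  refine le_antisymm ?_ zero_le
  have := iInf_le (fun γ : PiecewiseC1Path g g => γ.length G)
    (polylinePath (fun _ => g) (fun _ => mem_metrics_of_dim_zero g) 0)
  rwa [length_polylinePath, Finset.sum_range_zero] at this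

end DimensionZero

end MetricSpaceOfMetrics

theorem corollary5p8 (n : ℕ) (M : Type*) [TopologicalSpace M] [T2Space M] [CompactSpace M]
    [ChartedSpace (EuclideanSpace ℝ (Fin n)) M] [IsManifold (𝓡 n) ∞ M]
    [MeasurableSpace M] [BorelSpace M]
    (p : ℝ) (hp : p ≠ 1) (v v' : ℝ) (hv : 0 < v) (hvv' : v < v') :
    ∃ C : ℝ≥0, ∀ g ∈ MetricSpaceOfMetrics.metricsVolumeBetween n M v v',
      ∀ h ∈ MetricSpaceOfMetrics.metricsVolumeBetween n M v v',
        MetricSpaceOfMetrics.conformalEbinDist p g h ≠ ⊤ ∧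
        MetricSpaceOfMetrics.ebinDist g h ≠ ⊤ ∧
        MetricSpaceOfMetrics.conformalEbinDist p g h ≤ C * MetricSpaceOfMetrics.ebinDist g h ∧
        MetricSpaceOfMetrics.ebinDist g h ≤ C * MetricSpaceOfMetrics.conformalEbinDist p g h := by
  open MetricSpaceOfMetrics in
  -- In dimension zero the scaling exponent `n(1-p)/4` vanishes and the shrinking argument is
  -- unavailable.
  rcases eq_or_ne n 0 with rfl | hn
  · refine ⟨0, fun g _ h _ => ?_⟩
    simp only [conformalEbinDist, ebinDist, riemannianDist_of_dim_zero]
    simp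
  · simp only [ebinDist_eq_conformalEbinDist_zero]
    obtain ⟨D₁, hD₁⟩ := exists_conformalEbinDist_le (M := M) hn hp (v' := v') hv
    obtain ⟨D₂, hD₂⟩ := exists_conformalEbinDist_le (M := M) hn zero_ne_one (v' := v') hv
    obtain ⟨C₁, hC₁⟩ := exists_conformalEbinDist_le_mul (M := M) hn hp zero_ne_one hv hvv'
    obtain ⟨C₂, hC₂⟩ := exists_conformalEbinDist_le_mul (M := M) hn zero_ne_one hp hv hvv'
    refine ⟨max C₁ C₂, fun g hg h hh => ⟨ne_top_of_le_ne_top ENNReal.coe_ne_top (hD₁ g hg h hh),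
      ne_top_of_le_ne_top ENNReal.coe_ne_top (hD₂ g hg h hh),
      (hC₁ g hg h hh).trans ?_, (hC₂ g hg h hh).trans ?_⟩⟩
    · gcongr
      exact le_max_left _ _
    · gcongr
      exact le_max_right _ _
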